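/- For a squarefree integer $d\ge1$ let $E_d$ be the elliptic curve over $\mathbb Q$ with equation $dy^2=x^3-x$, and let $\hat h_{E_d}$ be its canonical height, normalized by $\hat h_{E_d}(P)=\tfrac12\lim_{n\to\infty}4^{-n}h_x(2^nP)$, where $h_x(P)$ is the logarithmic Weil height of the $x$-coordinate of $P$ (and $0$ for the point at infinity). Define $\eta_d(-1,0)\in(0,\infty]$ by $$\log\eta_d(-1,0)=\min\{\hat h_{E_d}(P):P\in E_d(\mathbb Q)\setminus E_d(\mathbb Q)_{\mathrm{tors}}\}$$ if $\operatorname{rank}E_d(\mathbb Q)\ge1$, and $\eta_d(-1,0)=\infty$ if $\operatorname{rank}E_d(\mathbb Q)=0$. Theorem. Let $\varepsilon>0$ be fixed. For almost every squarefree integer $d\ge1$ we have $$\eta_d(-1,0)>d^{5/8-\varepsilon},$$ that is, the proportion of the squarefree integers $1\le d\le X$ which satisfy this inequality tends to $1$ as $X\to\infty$. -/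

import Mathlib

open Filter Topology

namespace CongruentTwist

/-- The rational points of the curve `E_d : d y² = x³ - x` (a smooth projective curve, with the
single point `zero` at infinity). -/
inductive Point (d : ℕ+) : Type
  | zero : Point d
  | some (x y : ℚ) (h : (d : ℚ) * y ^ 2 = x ^ 3 - x) : Point d

/-- The Weierstrass model `Y² = X³ - d² X` of `E_d`, obtained by the linear change of variables
`X = d x`, `Y = d² y`. -/
def model (d : ℕ+) : WeierstrassCurve.Affine ℚ :=
  { a₁ := 0, a₂ := 0, a₃ := 0, a₄ := -(d : ℚ) ^ 2, a₆ := 0 }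

theorem cast_ne_zero (d : ℕ+) : (d : ℚ) ≠ 0 := by
  exact_mod_cast d.ne_zero

theorem model_equation_iff (d : ℕ+) (X Y : ℚ) :
    (model d).Equation X Y ↔ Y ^ 2 = X ^ 3 - (d : ℚ) ^ 2 * X := by
  rw [WeierstrassCurve.Affine.equation_iff]
  simp only [model]
  constructor <;> intro h <;> linarith

theorem model_nonsingular_iff (d : ℕ+) (X Y : ℚ) :
    (model d).Nonsingular X Y ↔ Y ^ 2 = X ^ 3 - (d : ℚ) ^ 2 * X := by
  rw [← model_equation_iff]
  refine (WeierstrassCurve.Affine.equation_iff_nonsingular_of_Δ_ne_zero ?_).symm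
  have hd := cast_ne_zero d
  have hΔ : (model d).Δ = 64 * (d : ℚ) ^ 6 := by
    simp only [model, WeierstrassCurve.Δ, WeierstrassCurve.b₂, WeierstrassCurve.b₄,
      WeierstrassCurve.b₆, WeierstrassCurve.b₈]
    ring
  rw [hΔ]
  positivity

theorem model_nonsingular_of_eq {d : ℕ+} {x y : ℚ} (h : (d : ℚ) * y ^ 2 = x ^ 3 - x) :
    (model d).Nonsingular ((d : ℚ) * x) ((d : ℚ) ^ 2 * y) := by
  rw [model_nonsingular_iff]
  linear_combination (d : ℚ) ^ 3 * h

theorem eq_of_model_nonsingular {d : ℕ+} {X Y : ℚ} (h : (model d).Nonsingular X Y) :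
    (d : ℚ) * (Y / (d : ℚ) ^ 2) ^ 2 = (X / (d : ℚ)) ^ 3 - X / (d : ℚ) := by
  rw [model_nonsingular_iff] at h
  have hd := cast_ne_zero d
  field_simp
  linear_combination h

/-- The isomorphism `(x, y) ↦ (d x, d² y)` from `E_d(ℚ)` to the rational points of the
Weierstrass model. -/
def Point.equivModel (d : ℕ+) : Point d ≃ (model d).Point where
  toFun
    | .zero => .zero
    | .some x y h => .some ((d : ℚ) * x) ((d : ℚ) ^ 2 * y) (model_nonsingular_of_eq h)
  invFun
    | .zero => .zero
    | .some X Y h => .some (X / (d : ℚ)) (Y / (d : ℚ) ^ 2) (eq_of_model_nonsingular h)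
  left_inv := by
    rintro (_ | ⟨x, y, h⟩)
    · rfl
    · have hd := cast_ne_zero d
      simp [hd]
  right_inv := by
    rintro (_ | ⟨X, Y, h⟩)
    · rfl
    · have hd := cast_ne_zero d
      simp [mul_div_cancel₀, hd]

/-- The group law on `E_d(ℚ)` (chord and tangent, with neutral element the point at infinity),
transported from the Weierstrass model; the change of variables is linear, so it maps lines to
lines. -/
noncomputable instance (d : ℕ+) : AddCommGroup (Point d) :=
  (Point.equivModel d).addCommGroup

/-- The height `h_x(P)`: the logarithmic Weil height of the `x`-coordinate, and `0` at infinity. -/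
noncomputable def Point.xHeight {d : ℕ+} : Point d → ℝ
  | .zero => 0
  | .some x _ _ => Height.logHeight₁ x

/-- The canonical height on `E_d`, in the normalization `ĥ = h_x / 2 + O(1)`:
`ĥ(P) = (1/2) lim 4⁻ⁿ h_x(2ⁿ P)`. -/
noncomputable def Point.canonicalHeight {d : ℕ+} (P : Point d) : ℝ :=
  (1 / 2) * limUnder atTop (fun n : ℕ => (2 ^ n • P).xHeight / 4 ^ n)

/-- `η_d(-1, 0) ∈ [0, ∞]`: the infimum (a minimum, when there is a non-torsion point) of
`exp ĥ(P)` over the non-torsion points `P ∈ E_d(ℚ)`. It is `∞` when all points are torsion,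
that is, when the rank is `0`. -/
noncomputable def eta (d : ℕ+) : ENNReal :=
  ⨅ (P : Point d) (_ : ¬ IsOfFinAddOrder P), ENNReal.ofReal (Real.exp P.canonicalHeight)

end CongruentTwist

/-- The set of positive squarefree integers up to `X`. -/
def squarefreeUpTo (X : ℕ) : Set ℕ+ :=
  {d | Squarefree (d : ℕ) ∧ (d : ℕ) ≤ X}

/-- `P d` holds for almost every squarefree integer `d ≥ 1`: among the squarefree integers
`1 ≤ d ≤ X`, the proportion of those for which `P d` holds tends to `1` as `X → ∞`. -/
def AlmostEverySquarefree (P : ℕ+ → Prop) : Prop :=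
  Tendsto (fun X : ℕ =>
    (({d ∈ squarefreeUpTo X | P d}).ncard : ℝ) / ((squarefreeUpTo X).ncard : ℝ)) atTop (𝓝 1)

/-!
Along the isomorphism `E_d ≅ E_1` over `ℚ̄` the `x`-coordinate is unchanged, so duplication acts on
`x` by a map independent of `d`, and `ĥ(P) ≥ h_x(P) / 2 - 1` with a constant independent of `d`
(`CongruentTwist.Point.xHeight_le_canonicalHeight`). Hence it suffices to show that only `o(X)`
squarefree `d ≤ X` have a point with `y ≠ 0` whose `x`-coordinate has multiplicative height
at most `T`, a constant times `X ^ (5 / 4 - 2 ε)`.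

If `x = ± (A / C) ^ (± 1)` is such a point, with `A > C > 0` coprime, then `d` is the squarefree part
of `A C (A - C) (A + C)`. One can arrange that `A` and `C` have opposite parity; then the four
factors are pairwise coprime, equal to `d₁ u₁²`, `d₂ u₂²`, `d₃ u₃²`, `d₄ u₄²`, with `d = d₁ d₂ d₃ d₄`
(`Descent`). One of the four products of three of the `dᵢ` is at most `X ^ (3 / 4)`, and the three
corresponding `uᵢ` give a point on a conic, since any three of the forms `A, C, A - C, A + C` are
linearly dependent. This point determines `A` and `C`, hence `d`.

For given coefficients with product `E`, the points of height at most `M` on such a conic number at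
most `2 τ(e₁) τ(e₂) τ(e₃) (1 + 2 √(M / E))` (`ConicPoint.card_le`): the points fall into
`τ(e₁) τ(e₂) τ(e₃)` classes modulo the coefficients, such that `E` divides the determinant of any
three points of a class, while three points on a short arc have a determinant less than `E`. Such
a determinant vanishes, but a line meets a conic in at most two points. Summing over `E ≤ N`, with
`N = X ^ (3 / 4)`, gives `O((N + √(T N)) (log X) ^ 6) = O(X ^ (1 - ε) (log X) ^ 6)` exceptional `d`,
which is negligible because the squarefree integers have positive density.
-/

/-! ### The canonical height and the height of the `x`-coordinate -/

/-- The map `x ↦ (x² + 1)² / (4 (x³ - x))` raises the height to the fourth power, up to a bounded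
factor: in terms of `x = a / b`, numerator and denominator have at most the factor `16` in common. -/
theorem Rat.height_div_bounds {a b : ℤ} (hab : IsCoprime a b) (hD : 4 * a * b * (a ^ 2 - b ^ 2) ≠ 0) :
    Height.mulHeight₁ (((a : ℚ) ^ 2 + b ^ 2) ^ 2 / (4 * a * b * (a ^ 2 - b ^ 2))) ≤
        16 * (max |a| |b| : ℤ) ^ 4 ∧
      ((max |a| |b| : ℤ) : ℝ) ^ 4 ≤
        16 * Height.mulHeight₁ (((a : ℚ) ^ 2 + b ^ 2) ^ 2 / (4 * a * b * (a ^ 2 - b ^ 2))) := by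
  set q : ℚ := ((a : ℚ) ^ 2 + b ^ 2) ^ 2 / (4 * a * b * (a ^ 2 - b ^ 2)) with hq
  obtain ⟨c, hN, hDc⟩ := Rat.exists_eq_mul_div_num_and_eq_mul_div_den ((a ^ 2 + b ^ 2) ^ 2) hD
  have hqq : (((a ^ 2 + b ^ 2) ^ 2 : ℤ) : ℚ) / ((4 * a * b * (a ^ 2 - b ^ 2) : ℤ) : ℚ) = q := by
    push_cast; rfl
  rw [hqq] at hN hDc
  have hc0 : c ≠ 0 := by
    rintro rfl
    simp at hDc
    exact hD (by simpa using hDc)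
  -- The two forms have resultant a power of `2`; these are the corresponding Bézout identities.
  have hca : c ∣ 16 * a ^ 7 := by
    have : (16 * a ^ 7 : ℤ) = (a ^ 2 + b ^ 2) ^ 2 * (16 * a ^ 3 - 12 * a * b ^ 2) -
        4 * a * b * (a ^ 2 - b ^ 2) * (5 * a ^ 2 * b + 3 * b ^ 3) := by ring
    rw [this]
    exact dvd_sub (Dvd.dvd.mul_right ⟨_, hN⟩ _) (Dvd.dvd.mul_right ⟨_, hDc⟩ _)
  have hcb : c ∣ 16 * b ^ 7 := by
    have : (16 * b ^ 7 : ℤ) = (a ^ 2 + b ^ 2) ^ 2 * (16 * b ^ 3 - 12 * b * a ^ 2) +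
        4 * a * b * (a ^ 2 - b ^ 2) * (5 * b ^ 2 * a + 3 * a ^ 3) := by ring
    rw [this]
    exact dvd_add (Dvd.dvd.mul_right ⟨_, hN⟩ _) (Dvd.dvd.mul_right ⟨_, hDc⟩ _)
  have hc : c ∣ 16 := by
    obtain ⟨r, s, hrs⟩ := (hab.pow (m := 7) (n := 7))
    have : (16 : ℤ) = r * (16 * a ^ 7) + s * (16 * b ^ 7) := by linear_combination -16 * hrs
    rw [this]
    exact dvd_add (hca.mul_left _) (hcb.mul_left _)
  have hc16 : |c| ≤ 16 := by
    have := Int.le_of_dvd (by norm_num) ((abs_dvd c 16).2 hc)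
    exact this
  have hc1 : 1 ≤ |c| := Int.one_le_abs hc0
  have hNa : (a ^ 2 + b ^ 2) ^ 2 = |c| * |q.num| := by
    rw [← abs_mul, ← hN, abs_of_nonneg (by positivity)]
  have hDa : |4 * a * b * (a ^ 2 - b ^ 2)| = |c| * q.den := by
    rw [hDc, abs_mul, Nat.abs_cast]
  have hH : Height.mulHeight₁ q = ((max |q.num| (q.den : ℤ) : ℤ) : ℝ) := by
    rw [Rat.mulHeight₁_eq_max]
    push_cast
    rw [Nat.cast_natAbs]
    push_cast
    rfl
  rw [hH]
  set H := max |a| |b| with hHdef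
  have haH : |a| ≤ H := le_max_left _ _
  have hbH : |b| ≤ H := le_max_right _ _
  have hH0 : 0 ≤ H := (abs_nonneg a).trans haH
  have ha2 : a ^ 2 ≤ H ^ 2 := sq_le_sq.2 (by rwa [abs_of_nonneg hH0])
  have hb2 : b ^ 2 ≤ H ^ 2 := sq_le_sq.2 (by rwa [abs_of_nonneg hH0])
  constructor
  · have h1 : |q.num| ≤ 16 * H ^ 4 := by
      have : |q.num| ≤ |c| * |q.num| := le_mul_of_one_le_left (abs_nonneg _) hc1
      have h2 : (a ^ 2 + b ^ 2) ^ 2 ≤ (H ^ 2 + H ^ 2) ^ 2 := by gcongr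
      nlinarith [sq_nonneg (H ^ 2)]
    have h2 : (q.den : ℤ) ≤ 16 * H ^ 4 := by
      have : (q.den : ℤ) ≤ |c| * q.den := le_mul_of_one_le_left (by positivity) hc1
      have h3 : |4 * a * b * (a ^ 2 - b ^ 2)| ≤ 4 * H * H * (H ^ 2 + H ^ 2) := by
        rw [abs_mul, abs_mul, abs_mul]
        have : |a ^ 2 - b ^ 2| ≤ H ^ 2 + H ^ 2 := by
          rw [abs_le]; constructor <;> nlinarith [sq_nonneg a, sq_nonneg b]
        have h4 : |(4 : ℤ)| = 4 := rfl
        rw [h4]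
        gcongr
      nlinarith [sq_nonneg (H ^ 2)]
    exact_mod_cast max_le h1 h2
  · have h1 : H ^ 4 ≤ (a ^ 2 + b ^ 2) ^ 2 := by
      have : H ^ 2 ≤ a ^ 2 + b ^ 2 := by
        rcases max_choice |a| |b| with h | h <;> rw [hHdef, h, sq_abs] <;> nlinarith [sq_nonneg a, sq_nonneg b]
      calc H ^ 4 = (H ^ 2) ^ 2 := by ring
        _ ≤ _ := by gcongr
    have h2 : H ^ 4 ≤ 16 * max |q.num| (q.den : ℤ) := by
      calc H ^ 4 ≤ |c| * |q.num| := hNa ▸ h1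
        _ ≤ 16 * max |q.num| (q.den : ℤ) := by
          gcongr
          exact le_max_left _ _
    exact_mod_cast h2

namespace CongruentTwist

theorem Point.equivModel_add {d : ℕ+} (P Q : Point d) :
    Point.equivModel d (P + Q) = Point.equivModel d P + Point.equivModel d Q :=
  (Point.equivModel d).apply_symm_apply _

theorem Point.equivModel_zero (d : ℕ+) : Point.equivModel d 0 = 0 :=
  (Point.equivModel d).apply_symm_apply 0

theorem Point.zero_eq (d : ℕ+) : (Point.zero : Point d) = 0 := by
  apply (Point.equivModel d).injective
  rw [Point.equivModel_zero]; rfl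

theorem Point.add_self_of_y_eq_zero {d : ℕ+} {x y : ℚ} (h : (d : ℚ) * y ^ 2 = x ^ 3 - x)
    (hy : y = 0) : Point.some x y h + Point.some x y h = 0 := by
  apply (Point.equivModel d).injective
  rw [Point.equivModel_zero, Point.equivModel_add]
  exact WeierstrassCurve.Affine.Point.add_self_of_Y_eq (by
    simp [WeierstrassCurve.Affine.negY, model, hy])

/-- The duplication formula: the `x`-coordinate of `2P` does not depend on `d`. -/
theorem Point.exists_add_self {d : ℕ+} {x y : ℚ} (h : (d : ℚ) * y ^ 2 = x ^ 3 - x)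
    (hy : y ≠ 0) : ∃ y' h', Point.some x y h + Point.some x y h =
      Point.some ((x ^ 2 + 1) ^ 2 / (4 * (x ^ 3 - x))) y' h' := by
  have hd := cast_ne_zero d
  have hne : (d : ℚ) ^ 2 * y ≠ (model d).negY ((d : ℚ) * x) ((d : ℚ) ^ 2 * y) := by
    simp only [WeierstrassCurve.Affine.negY, model]
    intro h0
    apply hy
    have : 2 * ((d : ℚ) ^ 2 * y) = 0 := by linarith
    simpa [hd] using this
  have key := WeierstrassCurve.Affine.Point.add_self_of_Y_ne (W := model d)
    (h₁ := model_nonsingular_of_eq h) hne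
  have h1 : Point.some x y h + Point.some x y h = (Point.equivModel d).symm
      (WeierstrassCurve.Affine.Point.some _ _ (model_nonsingular_of_eq h) +
        WeierstrassCurve.Affine.Point.some _ _ (model_nonsingular_of_eq h)) := rfl
  rw [key] at h1
  rw [h1]
  have hX : (model d).addX ((d : ℚ) * x) ((d : ℚ) * x) ((model d).slope ((d : ℚ) * x) ((d : ℚ) * x)
      ((d : ℚ) ^ 2 * y) ((d : ℚ) ^ 2 * y)) / d = (x ^ 2 + 1) ^ 2 / (4 * (x ^ 3 - x)) := by
    rw [WeierstrassCurve.Affine.slope_of_Y_ne rfl hne, ← h]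
    simp only [WeierstrassCurve.Affine.addX, WeierstrassCurve.Affine.negY, model]
    have h2 : (d : ℚ) ^ 2 * y - (-((d : ℚ) ^ 2 * y) - 0 * (d * x) - 0) = 2 * d ^ 2 * y := by ring
    rw [h2]
    field_simp
    linear_combination (-32 * x * d ^ 2) * h
  have gen : ∀ (X Y : ℚ) (hXY : (model d).Nonsingular X Y) (x' : ℚ), X / d = x' →
      ∃ y' h', (Point.equivModel d).symm (WeierstrassCurve.Affine.Point.some X Y hXY) =
        Point.some x' y' h' := by
    rintro X Y hXY x' rfl
    exact ⟨_, eq_of_model_nonsingular hXY, rfl⟩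
  exact gen _ _ _ _ hX

theorem Point.exists_of_not_isOfFinAddOrder {d : ℕ+} {P : Point d} (hP : ¬ IsOfFinAddOrder P) :
    ∃ x y h, y ≠ 0 ∧ P = Point.some x y h := by
  rcases P with _ | ⟨x, y, h⟩
  · exact absurd (Point.zero_eq d ▸ IsOfFinAddOrder.zero) hP
  · refine ⟨x, y, h, fun hy => hP ?_, rfl⟩
    rw [isOfFinAddOrder_iff_nsmul_eq_zero]
    exact ⟨2, by norm_num, by rw [two_nsmul]; exact Point.add_self_of_y_eq_zero h hy⟩

/-- The height multiplies by four under duplication, with an error independent of `d`. -/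
theorem Point.abs_xHeight_two_nsmul_sub_le {d : ℕ+} {P : Point d} (hP : ¬ IsOfFinAddOrder P) :
    |(2 • P).xHeight - 4 * P.xHeight| ≤ Real.log 16 := by
  obtain ⟨x, y, h, hy, rfl⟩ := Point.exists_of_not_isOfFinAddOrder hP
  obtain ⟨y', h', h2⟩ := Point.exists_add_self h hy
  rw [two_nsmul, h2]
  simp only [Point.xHeight, Height.logHeight₁_eq_log_mulHeight₁]
  have hd := cast_ne_zero d
  have hb : (x.den : ℚ) ≠ 0 := by exact_mod_cast x.den_nz
  have hx : x = x.num / (x.den : ℤ) := by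
    push_cast
    exact (Rat.num_div_den x).symm
  have hcop : IsCoprime x.num (x.den : ℤ) := by
    rw [Int.isCoprime_iff_gcd_eq_one]
    exact x.reduced
  set a := x.num with ha
  set b : ℤ := (x.den : ℤ) with hbdef
  have hbz : (b : ℚ) ≠ 0 := by rw [hbdef]; exact_mod_cast x.den_nz
  have hD : 4 * (a : ℚ) * b * (a ^ 2 - b ^ 2) = 4 * (d * y ^ 2) * b ^ 4 := by
    rw [h, hx]
    field_simp
  have hD0 : 4 * a * b * (a ^ 2 - b ^ 2) ≠ 0 := by
    have : 4 * (a : ℚ) * b * (a ^ 2 - b ^ 2) ≠ 0 := by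
      rw [hD]; positivity
    exact_mod_cast this
  have hq : (x ^ 2 + 1) ^ 2 / (4 * (x ^ 3 - x)) =
      ((a : ℚ) ^ 2 + b ^ 2) ^ 2 / (4 * a * b * (a ^ 2 - b ^ 2)) := by
    rw [hD, h, hx]
    have : x ^ 3 - x ≠ 0 := by rw [← h]; positivity
    rw [hx] at this
    field_simp
  obtain ⟨hle, hge⟩ := Rat.height_div_bounds hcop hD0
  rw [← hq] at hle hge
  have hmax : ((max |a| |b| : ℤ) : ℝ) = Height.mulHeight₁ x := by
    rw [Rat.mulHeight₁_eq_max, hbdef, ha]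
    push_cast
    simp
  rw [hmax] at hle hge
  have p1 := Height.mulHeight₁_pos x
  have p2 := Height.mulHeight₁_pos ((x ^ 2 + 1) ^ 2 / (4 * (x ^ 3 - x)))
  have l1 := Real.log_le_log p2 hle
  have l2 := Real.log_le_log (by positivity) hge
  rw [Real.log_mul (by norm_num) (by positivity), Real.log_pow] at l1
  rw [Real.log_mul (by norm_num) (by positivity), Real.log_pow] at l2
  push_cast at l1 l2
  rw [abs_le]
  constructor <;> linarith

theorem Point.not_isOfFinAddOrder_nsmul {d : ℕ+} {P : Point d} (hP : ¬ IsOfFinAddOrder P)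
    (n : ℕ) : ¬ IsOfFinAddOrder (2 ^ n • P) := by
  rw [isOfFinAddOrder_nsmul]
  simp [hP]

/-- The difference between the canonical height and half of the naive height is bounded below
uniformly in `d`, because all the `E_d` are isomorphic over `ℚ̄` with the same `x`-coordinate. -/
theorem Point.xHeight_le_canonicalHeight {d : ℕ+} {P : Point d} (hP : ¬ IsOfFinAddOrder P) :
    P.xHeight / 2 - 1 ≤ P.canonicalHeight := by
  -- The sequence defining the canonical height is Cauchy, so `limUnder` is a genuine limit.
  set f : ℕ → ℝ := fun n => (2 ^ n • P).xHeight / 4 ^ n with hf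
  have hstep : ∀ n, dist (f n) (f (n + 1)) ≤ Real.log 16 / 4 * (1 / 4) ^ n := by
    intro n
    have h := Point.abs_xHeight_two_nsmul_sub_le (Point.not_isOfFinAddOrder_nsmul hP n)
    rw [smul_smul, ← pow_succ'] at h
    have : f n - f (n + 1) = -((2 ^ (n + 1) • P).xHeight - 4 * (2 ^ n • P).xHeight) / 4 ^ (n + 1) := by
      simp only [hf]
      field_simp
      ring
    rw [Real.dist_eq, this, abs_div, abs_neg, abs_of_pos (by positivity : (0 : ℝ) < 4 ^ (n + 1)),
      div_le_iff₀ (by positivity)]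
    refine h.trans (le_of_eq ?_)
    rw [pow_succ, one_div, inv_pow]
    field_simp
  have hcau : CauchySeq f := cauchySeq_of_le_geometric (1 / 4) _ (by norm_num) hstep
  obtain ⟨L, hL⟩ := cauchySeq_tendsto_of_complete hcau
  have hd := dist_le_of_le_geometric_of_tendsto₀ (1 / 4) _ (by norm_num) hstep hL
  have h0 : f 0 = P.xHeight := by simp [hf]
  rw [h0, Real.dist_eq] at hd
  have hlim : P.canonicalHeight = 1 / 2 * L := by
    unfold Point.canonicalHeight
    rw [hL.limUnder_eq]
  have hlog : Real.log 16 = 4 * Real.log 2 := by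
    rw [show (16 : ℝ) = 2 ^ 4 by norm_num, Real.log_pow]; norm_num
  rw [hlog] at hd
  have := Real.log_two_lt_d9
  have := (abs_le.1 hd).2
  rw [hlim]
  norm_num at this
  linarith

theorem exp_mul_sqrt_mulHeight₁_le_exp_canonicalHeight {d : ℕ+} {x y : ℚ} {h : (d : ℚ) * y ^ 2 = x ^ 3 - x}
    (hP : ¬ IsOfFinAddOrder (Point.some x y h)) :
    Real.exp (-1) * √(Height.mulHeight₁ x) ≤ Real.exp (Point.some x y h).canonicalHeight := by
  have h1 := Point.xHeight_le_canonicalHeight hP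
  have hpos := Height.mulHeight₁_pos x
  simp only [Point.xHeight, Height.logHeight₁_eq_log_mulHeight₁] at h1
  refine le_trans (le_of_eq ?_) (Real.exp_le_exp.2 h1)
  rw [sub_eq_neg_add, Real.exp_add, ← Real.log_sqrt hpos.le, Real.exp_log (by positivity)]

end CongruentTwist

/-! ### Rational points on conics -/

/-- If the ratios `y / z` and `y' / z'` have the same square modulo the squarefree `e` as `y₀ / z₀`,
and agree with it modulo the same primes, then they agree modulo `e`. -/
theorem Squarefree.dvd_cross_sub {e : ℕ} (he : Squarefree e) {y z y' z' y₀ z₀ : ℤ}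
    (hz₀ : IsCoprime (e : ℤ) z₀)
    (h : (e : ℤ) ∣ (y * z₀ - y₀ * z) * (y * z₀ + y₀ * z))
    (h' : (e : ℤ) ∣ (y' * z₀ - y₀ * z') * (y' * z₀ + y₀ * z'))
    (hg : Int.gcd e (y * z₀ - y₀ * z) = Int.gcd e (y' * z₀ - y₀ * z')) :
    (e : ℤ) ∣ y * z' - y' * z := by
  -- Both ratios are `y₀ / z₀` modulo `g` and `-y₀ / z₀` modulo `e / g`.
  set g := Int.gcd e (y * z₀ - y₀ * z) with hgdef
  have hge : g ∣ e := by
    have := Int.gcd_dvd_left (e : ℤ) (y * z₀ - y₀ * z)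
    exact_mod_cast this
  obtain ⟨f, hf⟩ := hge
  have he0 : e ≠ 0 := he.ne_zero
  have hcop : Nat.Coprime g f := by
    rw [hf] at he
    exact Nat.coprime_of_squarefree_mul he
  have hgpos : g ≠ 0 := by rintro h0; rw [h0] at hf; simp at hf; exact he0 hf
  have key : ∀ u v : ℤ, (e : ℤ) ∣ (u - v) * (u + v) → Int.gcd e (u - v) = g → (f : ℤ) ∣ u + v := by
    intro u v huv hguv
    have h1 : (g : ℤ) ∣ u - v := hguv ▸ Int.gcd_dvd_right ..
    obtain ⟨w, hw⟩ := h1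
    have hfw : IsCoprime (f : ℤ) w := by
      rw [Int.isCoprime_iff_gcd_eq_one]
      rw [hf, hw] at hguv
      push_cast at hguv
      rw [Int.gcd_mul_left, Int.natAbs_natCast] at hguv
      exact Nat.eq_of_mul_eq_mul_left (Nat.pos_of_ne_zero hgpos) (by simpa using hguv)
    rw [hw, hf] at huv
    push_cast at huv
    rw [mul_assoc] at huv
    exact hfw.dvd_of_dvd_mul_left (Int.dvd_of_mul_dvd_mul_left (by exact_mod_cast hgpos) huv)
  have hz0g : IsCoprime (g : ℤ) z₀ :=
    hz₀.of_isCoprime_of_dvd_left (by rw [hf]; push_cast; exact dvd_mul_right _ _)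
  have hz0f : IsCoprime (f : ℤ) z₀ :=
    hz₀.of_isCoprime_of_dvd_left (by rw [hf]; push_cast; exact dvd_mul_left _ _)
  have d1 : (g : ℤ) ∣ y * z' - y' * z := by
    have a1 : (g : ℤ) ∣ y * z₀ - y₀ * z := Int.gcd_dvd_right ..
    have a2 : (g : ℤ) ∣ y' * z₀ - y₀ * z' := hg ▸ Int.gcd_dvd_right ..
    refine hz0g.dvd_of_dvd_mul_left (?_ : (g : ℤ) ∣ z₀ * (y * z' - y' * z))
    have : z₀ * (y * z' - y' * z) = (y * z₀ - y₀ * z) * z' - (y' * z₀ - y₀ * z') * z := by ring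
    rw [this]
    exact dvd_sub (a1.mul_right _) (a2.mul_right _)
  have d2 : (f : ℤ) ∣ y * z' - y' * z := by
    have a1 := key _ _ h rfl
    have a2 := key _ _ h' hg.symm
    refine hz0f.dvd_of_dvd_mul_left (?_ : (f : ℤ) ∣ z₀ * (y * z' - y' * z))
    have : z₀ * (y * z' - y' * z) = (y * z₀ + y₀ * z) * z' - (y' * z₀ + y₀ * z') * z := by ring
    rw [this]
    exact dvd_sub (a1.mul_right _) (a2.mul_right _)
  rw [hf]
  push_cast
  exact (Nat.isCoprime_iff_coprime.2 hcop).mul_dvd d1 d2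

/-- Conditions on the coefficients of a conic `k₁ e₁ x² + k₂ e₂ y² = k₃ e₃ z²`: the `eᵢ`, which serve
as moduli, are squarefree and pairwise coprime; the `kᵢ` allow for an additional factor `2`, and only
the coprimality conditions between the `eᵢ` and `kⱼ` that the congruences require are demanded. -/
structure ConicCoeffs (k₁ k₂ k₃ e₁ e₂ e₃ : ℕ) : Prop where
  k₁_pos : 0 < k₁
  k₂_pos : 0 < k₂
  k₃_pos : 0 < k₃
  sqf₁ : Squarefree e₁
  sqf₂ : Squarefree e₂
  sqf₃ : Squarefree e₃
  cop₁₂ : Nat.Coprime e₁ e₂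
  cop₁₃ : Nat.Coprime e₁ e₃
  cop₂₃ : Nat.Coprime e₂ e₃
  cop₁ : Nat.Coprime e₁ k₂
  cop₂ : Nat.Coprime e₂ k₁
  cop₃ : Nat.Coprime e₃ k₁

/-- A primitive positive point on the conic `k₁ e₁ x² + k₂ e₂ y² = k₃ e₃ z²`, with `k₃ e₃ z² ≤ M`;
`v` stands for `(x, y, z)`. -/
structure ConicPoint (k₁ k₂ k₃ e₁ e₂ e₃ : ℕ) (M : ℝ) (v : ℕ × ℕ × ℕ) : Prop where
  x_pos : 0 < v.1
  y_pos : 0 < v.2.1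
  z_pos : 0 < v.2.2
  eqn : k₁ * e₁ * v.1 ^ 2 + k₂ * e₂ * v.2.1 ^ 2 = k₃ * e₃ * v.2.2 ^ 2
  le : ((k₃ * e₃ * v.2.2 ^ 2 : ℕ) : ℝ) ≤ M
  cop_xy : Nat.Coprime v.1 v.2.1
  cop₁ : Nat.Coprime e₁ v.2.2
  cop₂ : Nat.Coprime e₂ v.2.2
  cop₃ : Nat.Coprime e₃ v.2.1

/-- The determinant of three vectors of `R³`. -/
def det₃ {R : Type*} [CommRing R] (v₁ v₂ v₃ : R × R × R) : R :=
  v₁.1 * (v₂.2.1 * v₃.2.2 - v₃.2.1 * v₂.2.2) - v₂.1 * (v₁.2.1 * v₃.2.2 - v₃.2.1 * v₁.2.2)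
    + v₃.1 * (v₁.2.1 * v₂.2.2 - v₂.2.1 * v₁.2.2)

/-- In terms of the rational parameter `t` of the circle, a determinant of three points is a
Vandermonde determinant, so it is small when the points are close. -/
theorem abs_det₃_circle_le {W δ : ℝ} {X₁ Y₁ Z₁ X₂ Y₂ Z₂ X₃ Y₃ Z₃ t₁ t₂ t₃ : ℝ}
    (h₁ : X₁ ^ 2 + Y₁ ^ 2 = Z₁ ^ 2) (h₂ : X₂ ^ 2 + Y₂ ^ 2 = Z₂ ^ 2) (h₃ : X₃ ^ 2 + Y₃ ^ 2 = Z₃ ^ 2)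
    (w₁ : 0 < Z₁ + Y₁) (w₂ : 0 < Z₂ + Y₂) (w₃ : 0 < Z₃ + Y₃)
    (W₁ : Z₁ + Y₁ ≤ W) (W₂ : Z₂ + Y₂ ≤ W) (W₃ : Z₃ + Y₃ ≤ W)
    (ht₁ : X₁ = t₁ * (Z₁ + Y₁)) (ht₂ : X₂ = t₂ * (Z₂ + Y₂)) (ht₃ : X₃ = t₃ * (Z₃ + Y₃))
    (h12 : |t₁ - t₂| ≤ δ) (h13 : |t₁ - t₃| ≤ δ) (h23 : |t₂ - t₃| ≤ δ) :
    2 * |det₃ (X₁, Y₁, Z₁) (X₂, Y₂, Z₂) (X₃, Y₃, Z₃)| ≤ (W * δ) ^ 3 ∧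
      (det₃ (X₁, Y₁, Z₁) (X₂, Y₂, Z₂) (X₃, Y₃, Z₃) = 0 → t₁ = t₂ ∨ t₁ = t₃ ∨ t₂ = t₃) := by
  have key : ∀ {X Y Z t : ℝ}, X ^ 2 + Y ^ 2 = Z ^ 2 → 0 < Z + Y → X = t * (Z + Y) →
      Y = (Z + Y) * (1 - t ^ 2) / 2 ∧ Z = (Z + Y) * (1 + t ^ 2) / 2 := by
    intro X Y Z t h w ht
    have : Z - Y = t ^ 2 * (Z + Y) := by
      apply mul_left_cancel₀ w.ne'
      rw [ht] at h
      linear_combination -h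
    constructor <;> linarith
  obtain ⟨a₁, b₁⟩ := key h₁ w₁ ht₁
  obtain ⟨a₂, b₂⟩ := key h₂ w₂ ht₂
  obtain ⟨a₃, b₃⟩ := key h₃ w₃ ht₃
  have hdet : 2 * det₃ (X₁, Y₁, Z₁) (X₂, Y₂, Z₂) (X₃, Y₃, Z₃) =
      (Z₁ + Y₁) * (Z₂ + Y₂) * (Z₃ + Y₃) * ((t₁ - t₂) * (t₁ - t₃) * (t₂ - t₃)) := by
    generalize Z₁ + Y₁ = u₁ at *
    generalize Z₂ + Y₂ = u₂ at *
    generalize Z₃ + Y₃ = u₃ at *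
    simp only [det₃]
    subst ht₁ ht₂ ht₃ a₁ a₂ a₃ b₁ b₂ b₃
    ring
  have hδ : 0 ≤ δ := (abs_nonneg _).trans h12
  have hW : 0 ≤ W := w₁.le.trans W₁
  constructor
  · rw [← abs_two (α := ℝ), ← abs_mul, hdet, abs_mul, abs_mul _ (t₂ - t₃), abs_mul (t₁ - t₂),
      abs_of_pos (by positivity)]
    calc _ ≤ (W * W * W) * (δ * δ * δ) := by gcongr
      _ = _ := by ring
  · intro h0
    rw [h0, mul_zero] at hdet
    have := (mul_eq_zero.1 hdet.symm).resolve_left (by positivity)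
    rcases mul_eq_zero.1 this with h | h
    · rcases mul_eq_zero.1 h with h | h
      · exact Or.inl (sub_eq_zero.1 h)
      · exact Or.inr (Or.inl (sub_eq_zero.1 h))
    · exact Or.inr (Or.inr (sub_eq_zero.1 h))

section Conic

variable {k₁ k₂ k₃ e₁ e₂ e₃ : ℕ} {M : ℝ}

/-- The parameter `X / (Z + Y)` of the point `(X : Y : Z) = (√(k₁e₁) x : √(k₂e₂) y : √(k₃e₃) z)` of the
circle `X² + Y² = Z²`; it lies in `[0, 1]`. -/
noncomputable def conicParam (k₁ k₂ k₃ e₁ e₂ e₃ : ℕ) (v : ℕ × ℕ × ℕ) : ℝ :=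
  √(k₁ * e₁ : ℕ) * v.1 / (√(k₃ * e₃ : ℕ) * v.2.2 + √(k₂ * e₂ : ℕ) * v.2.1)

/-- The class of a point of the conic relative to a reference point `v₀`. Modulo a prime dividing
`e₁`, the ratio `y / z` is determined up to sign by the equation; the first component records the
primes at which the sign is that of `v₀`. The other components do this for `x / z` modulo `e₂` and
`x / y` modulo `e₃`. -/
def conicClass (e₁ e₂ e₃ : ℕ) (v₀ v : ℕ × ℕ × ℕ) : ℕ × ℕ × ℕ :=
  (Int.gcd e₁ ((v.2.1 : ℤ) * v₀.2.2 - v₀.2.1 * v.2.2),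
   Int.gcd e₂ ((v.1 : ℤ) * v₀.2.2 - v₀.1 * v.2.2),
   Int.gcd e₃ ((v.1 : ℤ) * v₀.2.1 - v₀.1 * v.2.1))

theorem ConicPoint.dvd_of_conicClass_eq (hc : ConicCoeffs k₁ k₂ k₃ e₁ e₂ e₃)
    {v₀ v v' : ℕ × ℕ × ℕ} (h₀ : ConicPoint k₁ k₂ k₃ e₁ e₂ e₃ M v₀)
    (h : ConicPoint k₁ k₂ k₃ e₁ e₂ e₃ M v) (h' : ConicPoint k₁ k₂ k₃ e₁ e₂ e₃ M v')
    (hcl : conicClass e₁ e₂ e₃ v₀ v = conicClass e₁ e₂ e₃ v₀ v') :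
    (e₁ : ℤ) ∣ v.2.1 * v'.2.2 - v'.2.1 * v.2.2 ∧ (e₂ : ℤ) ∣ v.1 * v'.2.2 - v'.1 * v.2.2 ∧
      (e₃ : ℤ) ∣ v.1 * v'.2.1 - v'.1 * v.2.1 := by
  simp only [conicClass, Prod.mk.injEq] at hcl
  obtain ⟨c1, c2, c3⟩ := hcl
  have q0 : (k₁ * e₁ * v₀.1 ^ 2 + k₂ * e₂ * v₀.2.1 ^ 2 : ℤ) = k₃ * e₃ * v₀.2.2 ^ 2 := by
    exact_mod_cast h₀.eqn
  have C : ∀ {a b : ℕ}, Nat.Coprime a b → IsCoprime (a : ℤ) b := fun h => Nat.isCoprime_iff_coprime.2 h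
  have A : ∀ {w : ℕ × ℕ × ℕ}, ConicPoint k₁ k₂ k₃ e₁ e₂ e₃ M w →
      (e₁ : ℤ) ∣ (w.2.1 * v₀.2.2 - v₀.2.1 * w.2.2) * (w.2.1 * v₀.2.2 + v₀.2.1 * w.2.2) ∧
      (e₂ : ℤ) ∣ (w.1 * v₀.2.2 - v₀.1 * w.2.2) * (w.1 * v₀.2.2 + v₀.1 * w.2.2) ∧
      (e₃ : ℤ) ∣ (w.1 * v₀.2.1 - v₀.1 * w.2.1) * (w.1 * v₀.2.1 + v₀.1 * w.2.1) := by
    intro w hw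
    have q : (k₁ * e₁ * w.1 ^ 2 + k₂ * e₂ * w.2.1 ^ 2 : ℤ) = k₃ * e₃ * w.2.2 ^ 2 := by
      exact_mod_cast hw.eqn
    refine ⟨((C hc.cop₁).mul_right (C hc.cop₁₂)).dvd_of_dvd_mul_left
        ⟨-k₁ * (w.1 ^ 2 * v₀.2.2 ^ 2 - v₀.1 ^ 2 * w.2.2 ^ 2), ?_⟩,
      ((C hc.cop₂).mul_right (C hc.cop₁₂.symm)).dvd_of_dvd_mul_left
        ⟨-k₂ * (w.2.1 ^ 2 * v₀.2.2 ^ 2 - v₀.2.1 ^ 2 * w.2.2 ^ 2), ?_⟩,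
      ((C hc.cop₃).mul_right (C hc.cop₁₃.symm)).dvd_of_dvd_mul_left
        ⟨k₃ * (w.2.2 ^ 2 * v₀.2.1 ^ 2 - v₀.2.2 ^ 2 * w.2.1 ^ 2), ?_⟩⟩
    · linear_combination (v₀.2.2 : ℤ) ^ 2 * q - (w.2.2 : ℤ) ^ 2 * q0
    · linear_combination (v₀.2.2 : ℤ) ^ 2 * q - (w.2.2 : ℤ) ^ 2 * q0
    · linear_combination (v₀.2.1 : ℤ) ^ 2 * q - (w.2.1 : ℤ) ^ 2 * q0
  obtain ⟨a1, a2, a3⟩ := A h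
  obtain ⟨b1, b2, b3⟩ := A h'
  exact ⟨hc.sqf₁.dvd_cross_sub (C h₀.cop₁) a1 b1 c1, hc.sqf₂.dvd_cross_sub (C h₀.cop₂) a2 b2 c2,
    hc.sqf₃.dvd_cross_sub (C h₀.cop₃) a3 b3 c3⟩

/-- The cast of a vector of natural numbers to a commutative ring. -/
def castVec (R : Type*) [NatCast R] (v : ℕ × ℕ × ℕ) : R × R × R := (v.1, v.2.1, v.2.2)

/-- The points of one class are pairwise proportional modulo `eᵢ` outside the `i`-th coordinate, so
`eᵢ` divides their determinants. -/
theorem ConicPoint.dvd_det₃ (hc : ConicCoeffs k₁ k₂ k₃ e₁ e₂ e₃)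
    {v₀ v v' v'' : ℕ × ℕ × ℕ} (h₀ : ConicPoint k₁ k₂ k₃ e₁ e₂ e₃ M v₀)
    (h : ConicPoint k₁ k₂ k₃ e₁ e₂ e₃ M v) (h' : ConicPoint k₁ k₂ k₃ e₁ e₂ e₃ M v')
    (h'' : ConicPoint k₁ k₂ k₃ e₁ e₂ e₃ M v'')
    (hcl : conicClass e₁ e₂ e₃ v₀ v = conicClass e₁ e₂ e₃ v₀ v')
    (hcl' : conicClass e₁ e₂ e₃ v₀ v = conicClass e₁ e₂ e₃ v₀ v'') :
    ((e₁ * e₂ * e₃ : ℕ) : ℤ) ∣ det₃ (castVec ℤ v) (castVec ℤ v') (castVec ℤ v'') := by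
  have C : ∀ {a b : ℕ}, Nat.Coprime a b → IsCoprime (a : ℤ) b := fun h => Nat.isCoprime_iff_coprime.2 h
  obtain ⟨a1, a2, a3⟩ := h₀.dvd_of_conicClass_eq hc h h' hcl
  obtain ⟨b1, b2, b3⟩ := h₀.dvd_of_conicClass_eq hc h h'' hcl'
  obtain ⟨c1, c2, c3⟩ := h₀.dvd_of_conicClass_eq hc h' h'' (hcl.symm.trans hcl')
  have d1 : (e₁ : ℤ) ∣ det₃ (castVec ℤ v) (castVec ℤ v') (castVec ℤ v'') :=
    dvd_add (dvd_sub (c1.mul_left _) (b1.mul_left _)) (a1.mul_left _)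
  have d2 : (e₂ : ℤ) ∣ det₃ (castVec ℤ v) (castVec ℤ v') (castVec ℤ v'') := by
    have : det₃ (castVec ℤ v) (castVec ℤ v') (castVec ℤ v'') =
      -v.2.1 * (v'.1 * v''.2.2 - v''.1 * v'.2.2) + v'.2.1 * (v.1 * v''.2.2 - v''.1 * v.2.2)
        - v''.2.1 * (v.1 * v'.2.2 - v'.1 * v.2.2) := by
      simp only [det₃, castVec]; ring
    rw [this]
    exact dvd_sub (dvd_add (c2.mul_left _) (b2.mul_left _)) (a2.mul_left _)
  have d3 : (e₃ : ℤ) ∣ det₃ (castVec ℤ v) (castVec ℤ v') (castVec ℤ v'') := by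
    have : det₃ (castVec ℤ v) (castVec ℤ v') (castVec ℤ v'') =
      v.2.2 * (v'.1 * v''.2.1 - v''.1 * v'.2.1) - v'.2.2 * (v.1 * v''.2.1 - v''.1 * v.2.1)
        + v''.2.2 * (v.1 * v'.2.1 - v'.1 * v.2.1) := by
      simp only [det₃, castVec]; ring
    rw [this]
    exact dvd_add (dvd_sub (c3.mul_left _) (b3.mul_left _)) (a3.mul_left _)
  push_cast
  exact ((C hc.cop₁₃).mul_left (C hc.cop₂₃)).mul_dvd ((C hc.cop₁₂).mul_dvd d1 d2) d3

theorem ConicPoint.real_eqn {v : ℕ × ℕ × ℕ} (h : ConicPoint k₁ k₂ k₃ e₁ e₂ e₃ M v) :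
    (√(k₁ * e₁ : ℕ) * v.1) ^ 2 + (√(k₂ * e₂ : ℕ) * v.2.1) ^ 2 = (√(k₃ * e₃ : ℕ) * v.2.2) ^ 2 := by
  simp only [mul_pow, Real.sq_sqrt (Nat.cast_nonneg _)]
  exact_mod_cast h.eqn

theorem ConicPoint.denom_pos (hc : ConicCoeffs k₁ k₂ k₃ e₁ e₂ e₃) {v : ℕ × ℕ × ℕ}
    (h : ConicPoint k₁ k₂ k₃ e₁ e₂ e₃ M v) :
    0 < √(k₃ * e₃ : ℕ) * v.2.2 + √(k₂ * e₂ : ℕ) * v.2.1 := by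
  have a := h.y_pos
  have b := h.z_pos
  have := Nat.mul_pos hc.k₃_pos (Nat.pos_of_ne_zero hc.sqf₃.ne_zero)
  have := Nat.mul_pos hc.k₂_pos (Nat.pos_of_ne_zero hc.sqf₂.ne_zero)
  positivity

theorem ConicPoint.denom_le {v : ℕ × ℕ × ℕ} (h : ConicPoint k₁ k₂ k₃ e₁ e₂ e₃ M v) :
    √(k₃ * e₃ : ℕ) * v.2.2 + √(k₂ * e₂ : ℕ) * v.2.1 ≤ 2 * √M := by
  have hM := h.le
  have hq := h.real_eqn
  have hz : √(k₃ * e₃ : ℕ) * v.2.2 ≤ √M := by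
    apply Real.le_sqrt_of_sq_le
    rw [mul_pow, Real.sq_sqrt (Nat.cast_nonneg _)]
    exact_mod_cast hM
  have hy : √(k₂ * e₂ : ℕ) * v.2.1 ≤ √(k₃ * e₃ : ℕ) * v.2.2 := by
    apply le_of_sq_le_sq _ (by positivity)
    nlinarith [sq_nonneg (√(k₁ * e₁ : ℕ) * v.1)]
  linarith

theorem ConicPoint.conicParam_le_one (hc : ConicCoeffs k₁ k₂ k₃ e₁ e₂ e₃) {v : ℕ × ℕ × ℕ}
    (h : ConicPoint k₁ k₂ k₃ e₁ e₂ e₃ M v) : conicParam k₁ k₂ k₃ e₁ e₂ e₃ v ≤ 1 := by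
  have hq := h.real_eqn
  rw [conicParam, div_le_one (h.denom_pos hc)]
  have hx : √(k₁ * e₁ : ℕ) * v.1 ≤ √(k₃ * e₃ : ℕ) * v.2.2 := by
    apply le_of_sq_le_sq _ (by positivity)
    nlinarith [sq_nonneg (√(k₂ * e₂ : ℕ) * v.2.1)]
  have : 0 ≤ √(k₂ * e₂ : ℕ) * v.2.1 := by positivity
  linarith

/-- The parameter determines the point up to proportionality, and the point is primitive. -/
theorem ConicPoint.eq_of_conicParam_eq (hc : ConicCoeffs k₁ k₂ k₃ e₁ e₂ e₃) {v v' : ℕ × ℕ × ℕ}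
    (h : ConicPoint k₁ k₂ k₃ e₁ e₂ e₃ M v) (h' : ConicPoint k₁ k₂ k₃ e₁ e₂ e₃ M v')
    (ht : conicParam k₁ k₂ k₃ e₁ e₂ e₃ v = conicParam k₁ k₂ k₃ e₁ e₂ e₃ v') : v = v' := by
  have p1 := Nat.mul_pos hc.k₁_pos (Nat.pos_of_ne_zero hc.sqf₁.ne_zero)
  have p2 := Nat.mul_pos hc.k₂_pos (Nat.pos_of_ne_zero hc.sqf₂.ne_zero)
  have p3 := Nat.mul_pos hc.k₃_pos (Nat.pos_of_ne_zero hc.sqf₃.ne_zero)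
  have w := h.denom_pos hc
  have w' := h'.denom_pos hc
  have q := h.real_eqn
  have q' := h'.real_eqn
  simp only [conicParam] at ht
  have s1 : 0 < √(k₁ * e₁ : ℕ) := Real.sqrt_pos.2 (by exact_mod_cast p1)
  have s2 : 0 < √(k₂ * e₂ : ℕ) := Real.sqrt_pos.2 (by exact_mod_cast p2)
  set X := √(k₁ * e₁ : ℕ) * v.1 with hX
  set Y := √(k₂ * e₂ : ℕ) * v.2.1 with hY
  set Z := √(k₃ * e₃ : ℕ) * v.2.2 with hZ
  set X' := √(k₁ * e₁ : ℕ) * v'.1 with hX'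
  set Y' := √(k₂ * e₂ : ℕ) * v'.2.1 with hY'
  set Z' := √(k₃ * e₃ : ℕ) * v'.2.2 with hZ'
  rw [div_eq_div_iff w.ne' w'.ne'] at ht
  -- `X / (Z + Y) = X' / (Z' + Y')`, and `Z - Y = (X / (Z + Y))² (Z + Y)`
  have hYY : (Z - Y) * (Z' + Y') = (Z' - Y') * (Z + Y) := by
    apply mul_left_cancel₀ (mul_pos w w').ne'
    have e1 : (Z + Y) * (Z - Y) = X ^ 2 := by linear_combination -q
    have e2 : (Z' + Y') * (Z' - Y') = X' ^ 2 := by linear_combination -q'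
    calc (Z + Y) * (Z' + Y') * ((Z - Y) * (Z' + Y')) = (Z + Y) * (Z - Y) * (Z' + Y') ^ 2 := by ring
      _ = (X * (Z' + Y')) ^ 2 := by rw [e1]; ring
      _ = (X' * (Z + Y)) ^ 2 := by rw [ht]
      _ = (Z' + Y') * (Z' - Y') * (Z + Y) ^ 2 := by rw [e2]; ring
      _ = _ := by ring
  have hXY : X * Y' = X' * Y := by
    have e3 : Y * (Z' + Y') = Y' * (Z + Y) := by linear_combination -(1 / 2 : ℝ) * hYY
    apply mul_left_cancel₀ (mul_pos w w').ne'
    linear_combination (Y' * (Z + Y)) * ht - X' * (Z + Y) * e3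
  have hxy : v.1 * v'.2.1 = v'.1 * v.2.1 := by
    have : (√(k₁ * e₁ : ℕ) * √(k₂ * e₂ : ℕ)) * ((v.1 : ℝ) * v'.2.1) =
        (√(k₁ * e₁ : ℕ) * √(k₂ * e₂ : ℕ)) * ((v'.1 : ℝ) * v.2.1) := by
      rw [hX, hY, hX', hY'] at hXY
      linear_combination hXY
    exact_mod_cast mul_left_cancel₀ (mul_pos s1 s2).ne' this
  have hx : v.1 = v'.1 := by
    apply Nat.dvd_antisymm
    · exact h.cop_xy.dvd_of_dvd_mul_right (Dvd.intro _ hxy)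
    · exact h'.cop_xy.dvd_of_dvd_mul_right (Dvd.intro _ hxy.symm)
  have hy : v.2.1 = v'.2.1 := by
    rw [hx] at hxy
    exact (Nat.eq_of_mul_eq_mul_left h'.x_pos hxy).symm
  have hz : v.2.2 = v'.2.2 := by
    have e1 := h.eqn
    rw [hx, hy, h'.eqn] at e1
    exact (Nat.pow_left_injective (n := 2) (by norm_num) (Nat.eq_of_mul_eq_mul_left p3 e1)).symm
  exact Prod.ext hx (Prod.ext hy hz)

/-- The cell of a point: its class modulo `e₁`, `e₂`, `e₃`, and the interval of length
`√(e₁ e₂ e₃) / (2 √M)` in which its parameter lies. -/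
noncomputable def conicCell (k₁ k₂ k₃ e₁ e₂ e₃ : ℕ) (M : ℝ) (v₀ v : ℕ × ℕ × ℕ) :
    (ℕ × ℕ × ℕ) × ℕ :=
  (conicClass e₁ e₂ e₃ v₀ v,
    ⌊conicParam k₁ k₂ k₃ e₁ e₂ e₃ v / (√(e₁ * e₂ * e₃ : ℕ) / (2 * √M))⌋₊)

/-- Three points in the same cell have a determinant divisible by `e₁ e₂ e₃` and smaller than
`e₁ e₂ e₃`; so it vanishes, and two of them coincide, since a line meets a conic in at most two
points. -/
theorem ConicPoint.eq_or_eq_of_conicCell_eq (hc : ConicCoeffs k₁ k₂ k₃ e₁ e₂ e₃)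
    {v₀ v₁ v₂ v₃ : ℕ × ℕ × ℕ} (h₀ : ConicPoint k₁ k₂ k₃ e₁ e₂ e₃ M v₀)
    (h₁ : ConicPoint k₁ k₂ k₃ e₁ e₂ e₃ M v₁) (h₂ : ConicPoint k₁ k₂ k₃ e₁ e₂ e₃ M v₂)
    (h₃ : ConicPoint k₁ k₂ k₃ e₁ e₂ e₃ M v₃)
    (h12 : conicCell k₁ k₂ k₃ e₁ e₂ e₃ M v₀ v₁ = conicCell k₁ k₂ k₃ e₁ e₂ e₃ M v₀ v₂)
    (h13 : conicCell k₁ k₂ k₃ e₁ e₂ e₃ M v₀ v₁ = conicCell k₁ k₂ k₃ e₁ e₂ e₃ M v₀ v₃) :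
    v₁ = v₂ ∨ v₁ = v₃ ∨ v₂ = v₃ := by
  simp only [conicCell, Prod.mk.injEq] at h12 h13
  obtain ⟨c12, f12⟩ := h12
  obtain ⟨c13, f13⟩ := h13
  have hdvd := h₀.dvd_det₃ hc h₁ h₂ h₃ c12 c13
  have p1 := Nat.pos_of_ne_zero hc.sqf₁.ne_zero
  have p2 := Nat.pos_of_ne_zero hc.sqf₂.ne_zero
  have p3 := Nat.pos_of_ne_zero hc.sqf₃.ne_zero
  have hMpos : 0 < √M := by
    have := h₁.denom_pos hc
    have := h₁.denom_le
    linarith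
  set E : ℝ := ((e₁ * e₂ * e₃ : ℕ) : ℝ) with hE
  have hEpos : 0 < E := by positivity
  have hsE : 0 < √E := Real.sqrt_pos.2 hEpos
  set δ := √E / (2 * √M) with hδ
  have hδpos : 0 < δ := by positivity
  have hnn : ∀ v : ℕ × ℕ × ℕ, 0 ≤ conicParam k₁ k₂ k₃ e₁ e₂ e₃ v / δ := fun v => by
    unfold conicParam; positivity
  have close : ∀ v v' : ℕ × ℕ × ℕ, ⌊conicParam k₁ k₂ k₃ e₁ e₂ e₃ v / δ⌋₊ =
      ⌊conicParam k₁ k₂ k₃ e₁ e₂ e₃ v' / δ⌋₊ →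
      |conicParam k₁ k₂ k₃ e₁ e₂ e₃ v - conicParam k₁ k₂ k₃ e₁ e₂ e₃ v'| ≤ δ := by
    intro v v' hv
    have h1 := Nat.floor_le (hnn v)
    have h2 := Nat.lt_floor_add_one (conicParam k₁ k₂ k₃ e₁ e₂ e₃ v / δ)
    have h3 := Nat.floor_le (hnn v')
    have h4 := Nat.lt_floor_add_one (conicParam k₁ k₂ k₃ e₁ e₂ e₃ v' / δ)
    rw [← hv] at h3 h4
    have h5 : |conicParam k₁ k₂ k₃ e₁ e₂ e₃ v / δ - conicParam k₁ k₂ k₃ e₁ e₂ e₃ v' / δ| ≤ 1 := by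
      rw [abs_le]; constructor <;> linarith
    rwa [← sub_div, abs_div, abs_of_pos hδpos, div_le_one hδpos] at h5
  obtain ⟨hsmall, hzero⟩ := abs_det₃_circle_le h₁.real_eqn h₂.real_eqn h₃.real_eqn
    (h₁.denom_pos hc) (h₂.denom_pos hc) (h₃.denom_pos hc) h₁.denom_le h₂.denom_le h₃.denom_le
    (div_mul_cancel₀ _ (h₁.denom_pos hc).ne').symm (div_mul_cancel₀ _ (h₂.denom_pos hc).ne').symm
    (div_mul_cancel₀ _ (h₃.denom_pos hc).ne').symm
    (close _ _ f12) (close _ _ f13) (close _ _ (f12.symm.trans f13))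
  have hWδ : 2 * √M * δ = √E := by rw [hδ]; field_simp
  rw [hWδ] at hsmall
  set D := det₃ (castVec ℤ v₁) (castVec ℤ v₂) (castVec ℤ v₃) with hD
  have hscale : det₃ (√(k₁ * e₁ : ℕ) * v₁.1, √(k₂ * e₂ : ℕ) * v₁.2.1, √(k₃ * e₃ : ℕ) * v₁.2.2)
      (√(k₁ * e₁ : ℕ) * v₂.1, √(k₂ * e₂ : ℕ) * v₂.2.1, √(k₃ * e₃ : ℕ) * v₂.2.2)
      (√(k₁ * e₁ : ℕ) * v₃.1, √(k₂ * e₂ : ℕ) * v₃.2.1, √(k₃ * e₃ : ℕ) * v₃.2.2) =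
      √(k₁ * e₁ : ℕ) * √(k₂ * e₂ : ℕ) * √(k₃ * e₃ : ℕ) * (D : ℝ) := by
    simp only [hD, det₃, castVec]
    push_cast
    ring
  rw [hscale] at hsmall hzero
  have hprod : √E ≤ √(k₁ * e₁ : ℕ) * √(k₂ * e₂ : ℕ) * √(k₃ * e₃ : ℕ) := by
    rw [← Real.sqrt_mul (Nat.cast_nonneg _), ← Real.sqrt_mul (by positivity), hE]
    apply Real.sqrt_le_sqrt
    have : e₁ * e₂ * e₃ ≤ k₁ * e₁ * (k₂ * e₂) * (k₃ * e₃) := by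
      gcongr
      · exact Nat.le_mul_of_pos_left _ hc.k₁_pos
      · exact Nat.le_mul_of_pos_left _ hc.k₂_pos
      · exact Nat.le_mul_of_pos_left _ hc.k₃_pos
    exact_mod_cast this
  have hD0 : D = 0 := by
    refine Int.eq_zero_of_abs_lt_dvd hdvd ?_
    have h1 : 2 * (√E * |(D : ℝ)|) ≤ √E * E := by
      calc 2 * (√E * |(D : ℝ)|) ≤
          2 * (√(k₁ * e₁ : ℕ) * √(k₂ * e₂ : ℕ) * √(k₃ * e₃ : ℕ) * |(D : ℝ)|) := by gcongr
        _ = 2 * |√(k₁ * e₁ : ℕ) * √(k₂ * e₂ : ℕ) * √(k₃ * e₃ : ℕ) * (D : ℝ)| := by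
          rw [abs_mul _ (D : ℝ), abs_of_nonneg (hsE.le.trans hprod)]
        _ ≤ √E ^ 3 := hsmall
        _ = √E * E := by rw [pow_succ', Real.sq_sqrt hEpos.le]
    have h2 : 2 * |(D : ℝ)| ≤ E := by
      apply le_of_mul_le_mul_left _ hsE
      linarith
    have h3 : |(D : ℝ)| < E := by linarith [abs_nonneg (D : ℝ)]
    rw [hE] at h3
    exact_mod_cast h3
  rcases hzero (by rw [hD0]; simp) with h | h | h
  · exact Or.inl (h₁.eq_of_conicParam_eq hc h₂ h)
  · exact Or.inr (Or.inl (h₁.eq_of_conicParam_eq hc h₃ h))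
  · exact Or.inr (Or.inr (h₂.eq_of_conicParam_eq hc h₃ h))

/-- There are at most two points in each cell. -/
theorem ConicPoint.card_le (hc : ConicCoeffs k₁ k₂ k₃ e₁ e₂ e₃) (S : Finset (ℕ × ℕ × ℕ))
    (hS : ∀ v ∈ S, ConicPoint k₁ k₂ k₃ e₁ e₂ e₃ M v) :
    (S.card : ℝ) ≤ 2 * (e₁.divisors.card * e₂.divisors.card * e₃.divisors.card) *
      (1 + 2 * √M / √(e₁ * e₂ * e₃ : ℕ)) := by
  rcases S.eq_empty_or_nonempty with rfl | ⟨v₀, hv₀⟩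
  · simp only [Finset.card_empty, Nat.cast_zero]; positivity
  have h₀ := hS v₀ hv₀
  set δ := √(e₁ * e₂ * e₃ : ℕ) / (2 * √M) with hδ
  have hMpos : 0 < √M := by
    have := h₀.denom_pos hc
    have := h₀.denom_le
    linarith
  have hcard := Finset.card_le_mul_card_image_of_maps_to (s := S)
    (f := conicCell k₁ k₂ k₃ e₁ e₂ e₃ M v₀)
    (t := (e₁.divisors ×ˢ e₂.divisors ×ˢ e₃.divisors) ×ˢ Finset.range (⌊1 / δ⌋₊ + 1)) (n := 2)
    (fun v hv => by
      simp only [conicCell, conicClass, Finset.mem_product, Nat.mem_divisors, Finset.mem_range,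
        Nat.lt_succ_iff]
      have hg : ∀ (e : ℕ) (m : ℤ), Int.gcd e m ∣ e := fun e m => by
        have := Int.gcd_dvd_left (e : ℤ) m
        exact_mod_cast this
      refine ⟨⟨⟨hg _ _, hc.sqf₁.ne_zero⟩, ⟨hg _ _, hc.sqf₂.ne_zero⟩, ⟨hg _ _, hc.sqf₃.ne_zero⟩⟩,
        Nat.floor_le_floor ?_⟩
      have := (hS v hv).conicParam_le_one hc
      gcongr)
    (fun b _ => by
      by_contra! hlt
      obtain ⟨v₁, v₂, v₃, m₁, m₂, m₃, n12, n13, n23⟩ := Finset.two_lt_card_iff.1 hlt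
      simp only [Finset.mem_filter] at m₁ m₂ m₃
      rcases h₀.eq_or_eq_of_conicCell_eq hc (hS _ m₁.1) (hS _ m₂.1) (hS _ m₃.1)
        (m₁.2.trans m₂.2.symm) (m₁.2.trans m₃.2.symm) with h | h | h
      · exact n12 h
      · exact n13 h
      · exact n23 h)
  simp only [Finset.card_product, Finset.card_range] at hcard
  have hfl : ((⌊1 / δ⌋₊ : ℕ) : ℝ) ≤ 2 * √M / √(e₁ * e₂ * e₃ : ℕ) := by
    refine (Nat.floor_le (by positivity)).trans (le_of_eq ?_)
    rw [hδ, one_div_div]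
  calc (S.card : ℝ) ≤ ((2 * (e₁.divisors.card * (e₂.divisors.card * e₃.divisors.card) *
      (⌊1 / δ⌋₊ + 1)) : ℕ) : ℝ) := by exact_mod_cast hcard
    _ = 2 * (e₁.divisors.card * e₂.divisors.card * e₃.divisors.card) * (1 + (⌊1 / δ⌋₊ : ℕ)) := by
      push_cast; ring
    _ ≤ _ := by gcongr

end Conic

/-! ### Summation over conics -/

/-- The sum is at most `(∑ 1 / a)²`, as `τ(e) / e` is the sum of `1 / (a b)` over `a b = e`. -/
theorem sum_card_divisors_div_le (N : ℕ) :
    ∑ e ∈ Finset.Icc 1 N, (e.divisors.card : ℝ) / e ≤ (1 + Real.log N) ^ 2 := by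
  have hH : ∑ a ∈ Finset.Icc 1 N, (1 : ℝ) / a ≤ 1 + Real.log N := by
    have := harmonic_le_one_add_log N
    rw [harmonic_eq_sum_Icc] at this
    push_cast at this
    simpa only [one_div] using this
  have hnn : 0 ≤ ∑ a ∈ Finset.Icc 1 N, (1 : ℝ) / a := Finset.sum_nonneg fun _ _ => by positivity
  calc ∑ e ∈ Finset.Icc 1 N, (e.divisors.card : ℝ) / e
      = ∑ e ∈ Finset.Icc 1 N, ∑ p ∈ e.divisorsAntidiagonal, (1 : ℝ) / p.1 * (1 / p.2) := by
        refine Finset.sum_congr rfl fun e he => ?_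
        rw [Finset.sum_congr rfl (g := fun _ => (1 : ℝ) / e), Finset.sum_const, nsmul_eq_mul,
          mul_one_div, ← Nat.map_div_right_divisors, Finset.card_map]
        intro p hp
        rw [← (Nat.mem_divisorsAntidiagonal.1 hp).1]
        push_cast
        rw [one_div_mul_one_div]
    _ = ∑ q ∈ (Finset.Icc 1 N).sigma fun e => e.divisorsAntidiagonal,
          (1 : ℝ) / q.2.1 * (1 / q.2.2) := by rw [Finset.sum_sigma]
    _ ≤ ∑ p ∈ Finset.Icc 1 N ×ˢ Finset.Icc 1 N, (1 : ℝ) / p.1 * (1 / p.2) := by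
        rw [← Finset.sum_image (f := fun p : ℕ × ℕ => (1 : ℝ) / p.1 * (1 / p.2))
          (g := fun q : (_ : ℕ) × (ℕ × ℕ) => q.2)]
        · refine Finset.sum_le_sum_of_subset_of_nonneg ?_ fun _ _ _ => by positivity
          intro p hp
          obtain ⟨⟨e, q⟩, hq, rfl⟩ := Finset.mem_image.1 hp
          simp only [Finset.mem_sigma, Finset.mem_Icc, Nat.mem_divisorsAntidiagonal] at hq
          obtain ⟨⟨h1, h2⟩, h3, h4⟩ := hq
          have a1 : 0 < q.1 := Nat.pos_of_ne_zero (by rintro h; simp [h] at h3; omega)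
          have a2 : 0 < q.2 := Nat.pos_of_ne_zero (by rintro h; simp [h] at h3; omega)
          simp only [Finset.mem_product, Finset.mem_Icc]
          refine ⟨⟨a1, ?_⟩, a2, ?_⟩
          · exact (Nat.le_mul_of_pos_right _ a2).trans (h3.le.trans h2)
          · exact (Nat.le_mul_of_pos_left _ a1).trans (h3.le.trans h2)
        · rintro ⟨e, q⟩ h ⟨e', q'⟩ h' (rfl : q = q')
          simp only [Finset.coe_sigma, Set.mem_sigma_iff, Finset.mem_coe,
            Nat.mem_divisorsAntidiagonal] at h h'
          obtain rfl : e = e' := h.2.1.symm.trans h'.2.1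
          rfl
    _ = (∑ a ∈ Finset.Icc 1 N, (1 : ℝ) / a) ^ 2 := by
        rw [Finset.sum_product, sq, Finset.sum_mul_sum]
    _ ≤ _ := by gcongr

/-- The weight `τ(n) / n`. -/
noncomputable def divisorWeight (n : ℕ) : ℝ := (n.divisors.card : ℝ) / n

theorem sum_divisorWeight_le (N : ℕ) :
    ∑ t ∈ Finset.Icc 1 N ×ˢ Finset.Icc 1 N ×ˢ Finset.Icc 1 N,
      divisorWeight t.1 * (divisorWeight t.2.1 * divisorWeight t.2.2) ≤ (1 + Real.log N) ^ 6 := by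
  have h2 : ∑ q ∈ Finset.Icc 1 N ×ˢ Finset.Icc 1 N, divisorWeight q.1 * divisorWeight q.2 =
      (∑ n ∈ Finset.Icc 1 N, divisorWeight n) * ∑ n ∈ Finset.Icc 1 N, divisorWeight n := by
    rw [Finset.sum_mul_sum, Finset.sum_product]
  have h3 : ∑ t ∈ Finset.Icc 1 N ×ˢ Finset.Icc 1 N ×ˢ Finset.Icc 1 N,
      divisorWeight t.1 * (divisorWeight t.2.1 * divisorWeight t.2.2) =
      (∑ n ∈ Finset.Icc 1 N, divisorWeight n) *
        ∑ q ∈ Finset.Icc 1 N ×ˢ Finset.Icc 1 N, divisorWeight q.1 * divisorWeight q.2 := by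
    rw [Finset.sum_mul_sum, Finset.sum_product]
  rw [h3, h2]
  have h0 : 0 ≤ ∑ n ∈ Finset.Icc 1 N, divisorWeight n :=
    Finset.sum_nonneg fun n _ => by unfold divisorWeight; positivity
  calc _ = (∑ n ∈ Finset.Icc 1 N, divisorWeight n) ^ 3 := by ring
    _ ≤ ((1 + Real.log N) ^ 2) ^ 3 := pow_le_pow_left₀ h0 (sum_card_divisors_div_le N) 3
    _ = _ := by ring

theorem one_add_div_sqrt_le {M : ℝ} {E N : ℕ} (hE : 0 < E) (hEN : E ≤ N) :
    1 + 2 * √M / √E ≤ (N + 2 * (√M * √N)) / E := by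
  have hE' : (0 : ℝ) < E := by exact_mod_cast hE
  have hEN' : (E : ℝ) ≤ N := by exact_mod_cast hEN
  have hsE : 0 < √(E : ℝ) := Real.sqrt_pos.2 hE'
  have hsq := Real.mul_self_sqrt hE'.le
  rw [le_div_iff₀ hE']
  calc (1 + 2 * √M / √E) * E = (1 + 2 * √M / √E) * (√E * √E) := by rw [hsq]
    _ = √E * √E + 2 * (√M * √E) := by field_simp
    _ = E + 2 * (√M * √E) := by rw [hsq]
    _ ≤ _ := by gcongr

/-- A finite set that injects into the points of height at most `M` on the conics
`k₁ e₁ x² + k₂ e₂ y² = k₃ e₃ z²` with `e₁ e₂ e₃ ≤ N` has at most `O((N + √(M N)) (log N) ^ 6)` elements. -/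
theorem card_le_of_injOn_conicPoint {ι : Type*} (B : Finset ι) {k₁ k₂ k₃ N : ℕ} {M : ℝ}
    (e v : ι → ℕ × ℕ × ℕ)
    (hc : ∀ d ∈ B, ConicCoeffs k₁ k₂ k₃ (e d).1 (e d).2.1 (e d).2.2)
    (hN : ∀ d ∈ B, (e d).1 * (e d).2.1 * (e d).2.2 ≤ N)
    (hv : ∀ d ∈ B, ConicPoint k₁ k₂ k₃ (e d).1 (e d).2.1 (e d).2.2 M (v d))
    (hinj : ∀ d ∈ B, ∀ d' ∈ B, e d = e d' → v d = v d' → d = d') :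
    (B.card : ℝ) ≤ 2 * (N + 2 * (√M * √N)) * (1 + Real.log N) ^ 6 := by
  classical
  set I := Finset.Icc 1 N with hI
  have hmem : ∀ d ∈ B, e d ∈ I ×ˢ I ×ˢ I := by
    intro d hd
    have h1 := Nat.pos_of_ne_zero (hc d hd).sqf₁.ne_zero
    have h2 := Nat.pos_of_ne_zero (hc d hd).sqf₂.ne_zero
    have h3 := Nat.pos_of_ne_zero (hc d hd).sqf₃.ne_zero
    have h := hN d hd
    simp only [hI, Finset.mem_product, Finset.mem_Icc]
    refine ⟨⟨h1, ?_⟩, ⟨h2, ?_⟩, ⟨h3, ?_⟩⟩ <;> refine le_trans ?_ h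
    · rw [mul_assoc]; exact Nat.le_mul_of_pos_right _ (by positivity)
    · rw [mul_right_comm]; exact Nat.le_mul_of_pos_left _ (by positivity)
    · exact Nat.le_mul_of_pos_left _ (by positivity)
  have hfib : ∀ t ∈ I ×ˢ I ×ˢ I, ((B.filter fun d => e d = t).card : ℝ) ≤
      2 * (N + 2 * (√M * √N)) * (divisorWeight t.1 *
        (divisorWeight t.2.1 * divisorWeight t.2.2)) := by
    rintro ⟨e₁, e₂, e₃⟩ -
    rcases (B.filter fun d => e d = (e₁, e₂, e₃)).eq_empty_or_nonempty with h | ⟨d, hd⟩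
    · rw [h, Finset.card_empty, Nat.cast_zero]
      unfold divisorWeight; positivity
    rw [Finset.mem_filter] at hd
    have hcd := hc d hd.1
    have hNd := hN d hd.1
    rw [hd.2] at hcd hNd
    dsimp only at hcd hNd ⊢
    have hcard : ((B.filter fun d => e d = (e₁, e₂, e₃)).image v).card =
        (B.filter fun d => e d = (e₁, e₂, e₃)).card := by
      apply Finset.card_image_of_injOn
      intro a ha b hb hab
      simp only [Finset.coe_filter, Set.mem_ofPred_eq] at ha hb
      exact hinj a ha.1 b hb.1 (ha.2.trans hb.2.symm) hab
    have key := ConicPoint.card_le (M := M) hcd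
      ((B.filter fun d => e d = (e₁, e₂, e₃)).image v) (by
        intro u hu
        obtain ⟨a, ha, rfl⟩ := Finset.mem_image.1 hu
        rw [Finset.mem_filter] at ha
        have := hv a ha.1
        rw [ha.2] at this
        exact this)
    rw [hcard] at key
    refine key.trans ?_
    have p1 := Nat.pos_of_ne_zero hcd.sqf₁.ne_zero
    have p2 := Nat.pos_of_ne_zero hcd.sqf₂.ne_zero
    have p3 := Nat.pos_of_ne_zero hcd.sqf₃.ne_zero
    have h1 := one_add_div_sqrt_le (M := M) (E := e₁ * e₂ * e₃) (by positivity) hNd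
    calc _ ≤ 2 * ((e₁.divisors.card : ℝ) * e₂.divisors.card * e₃.divisors.card) *
          ((N + 2 * (√M * √N)) / (e₁ * e₂ * e₃ : ℕ)) :=
        mul_le_mul_of_nonneg_left h1 (by positivity)
      _ = _ := by
        unfold divisorWeight
        push_cast
        ring
  calc (B.card : ℝ) = ∑ t ∈ I ×ˢ I ×ˢ I, ((B.filter fun d => e d = t).card : ℝ) := by
        rw [Finset.card_eq_sum_card_fiberwise hmem]; push_cast; rfl
    _ ≤ ∑ t ∈ I ×ˢ I ×ˢ I, 2 * (N + 2 * (√M * √N)) * (divisorWeight t.1 *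
          (divisorWeight t.2.1 * divisorWeight t.2.2)) := Finset.sum_le_sum hfib
    _ = 2 * (N + 2 * (√M * √N)) * ∑ t ∈ I ×ˢ I ×ˢ I, (divisorWeight t.1 *
          (divisorWeight t.2.1 * divisorWeight t.2.2)) := by rw [← Finset.mul_sum]
    _ ≤ _ := mul_le_mul_of_nonneg_left (sum_divisorWeight_le N) (by positivity)

/-! ### The squarefree part of an integer -/

/-- The squarefree part of an integer is unique. -/
theorem Squarefree.eq_of_mul_sq_eq_mul_sq {a b m n : ℕ} (ha : Squarefree a) (hb : Squarefree b)
    (hm : m ≠ 0) (h : a * m ^ 2 = b * n ^ 2) : a = b := by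
  have hg : 0 < Nat.gcd m n := Nat.gcd_pos_of_pos_left _ (Nat.pos_of_ne_zero hm)
  obtain ⟨m', n', hcop, h1, h2⟩ := Nat.exists_coprime m n
  generalize m.gcd n = g at h1 h2 hg
  subst h1 h2
  rw [mul_pow, mul_pow, ← mul_assoc, ← mul_assoc] at h
  have h' := Nat.eq_of_mul_eq_mul_right (by positivity) h
  have c2 : Nat.Coprime (m' ^ 2) (n' ^ 2) := hcop.pow 2 2
  have d1 : m' * m' ∣ b := by
    rw [← sq]; exact c2.dvd_of_dvd_mul_right (Dvd.intro_left _ h')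
  have d2 : n' * n' ∣ a := by
    rw [← sq]; exact c2.symm.dvd_of_dvd_mul_right (Dvd.intro_left _ h'.symm)
  have e1 := Nat.isUnit_iff.1 (hb _ d1)
  have e2 := Nat.isUnit_iff.1 (ha _ d2)
  simpa [e1, e2] using h'

/-- `d` and `k` agree up to a nonzero rational square. -/
def SqEquiv (d k : ℕ) : Prop := ∃ m n : ℕ, m ≠ 0 ∧ n ≠ 0 ∧ d * m ^ 2 = k * n ^ 2

theorem SqEquiv.eq_of_squarefree {a b k : ℕ} (ha : Squarefree a) (hb : Squarefree b)
    (h : SqEquiv a k) (h' : SqEquiv b k) : a = b := by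
  obtain ⟨m, n, hm, hn, e⟩ := h
  obtain ⟨m', n', hm', hn', e'⟩ := h'
  refine ha.eq_of_mul_sq_eq_mul_sq (m := m * n') (n := m' * n) hb (by positivity) ?_
  calc a * (m * n') ^ 2 = (a * m ^ 2) * n' ^ 2 := by ring
    _ = (b * m' ^ 2) * n ^ 2 := by rw [e, e']; ring
    _ = _ := by ring

/-! ### Descent to conics -/

/-- The data attached to a point of `E_d` of height at most `T`: coprime `A > C > 0` of opposite
parity such that `d` is the squarefree part of `A C (A - C) (A + C)`, and the decompositions
`A = d₁ u₁²`, `C = d₂ u₂²`, `A - C = d₃ u₃²`, `A + C = d₄ u₄²`. The difference `A - C` is called `D`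
and the sum `A + C` is called `S`.
The number `d` is a field, so that finite sets of such data can be formed for varying `d`. -/
structure Descent (T : ℝ) where
  (d A C D S : ℕ)
  (d₁ d₂ d₃ d₄ u₁ u₂ u₃ u₄ : ℕ)
  hA : A = d₁ * u₁ ^ 2
  hC : C = d₂ * u₂ ^ 2
  hD : D = d₃ * u₃ ^ 2
  hS : S = d₄ * u₄ ^ 2
  add_D : C + D = A
  add_S : A + C = S
  C_pos : 0 < C
  D_pos : 0 < D
  A_le : (A : ℝ) ≤ T
  sqf : Squarefree (d₁ * d₂ * d₃ * d₄)
  copAC : Nat.Coprime A C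
  odd : Odd S
  equiv : SqEquiv d (A * C * D * S)
  prod : d₁ * d₂ * d₃ * d₄ = d

theorem Nat.Coprime.of_mul_sq {a b u v : ℕ} (h : Nat.Coprime (a * u ^ 2) (b * v ^ 2)) :
    Nat.Coprime a b ∧ Nat.Coprime a v ∧ Nat.Coprime u b ∧ Nat.Coprime u v := by
  have ha : a ∣ a * u ^ 2 := Dvd.intro _ rfl
  have hu : u ∣ a * u ^ 2 := (dvd_pow_self u two_ne_zero).mul_left _
  have hb : b ∣ b * v ^ 2 := Dvd.intro _ rfl
  have hv : v ∣ b * v ^ 2 := (dvd_pow_self v two_ne_zero).mul_left _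
  exact ⟨h.of_dvd ha hb, h.of_dvd ha hv, h.of_dvd hu hb, h.of_dvd hu hv⟩

theorem Nat.Coprime.sub_add {A C : ℕ} (h : Nat.Coprime A C) (hCA : C ≤ A) (hodd : Odd (A + C)) :
    Nat.Coprime (A - C) (A + C) := by
  have cD : Nat.Coprime (A - C) C := (Nat.coprime_sub_self_left hCA).2 h
  have e : A + C = (A - C) + 2 * C := by omega
  rw [e, Nat.coprime_self_add_right]
  refine Nat.Coprime.mul_right (Nat.Coprime.symm ?_) cD
  rw [Nat.coprime_two_left]
  rcases hodd with ⟨r, hr⟩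
  exact ⟨r - C, by omega⟩

namespace Descent

theorem exists_of_odd {d A C : ℕ} {T : ℝ} (hd : Squarefree d) (hC : 0 < C) (hCA : C < A)
    (hT : (A : ℝ) ≤ T) (hcop : Nat.Coprime A C) (hodd : Odd (A + C))
    (h : SqEquiv d (A * C * (A - C) * (A + C))) : ∃ a : Descent T, a.d = d := by
  have decomp : ∀ x : ℕ, 0 < x → ∃ a u : ℕ, x = a * u ^ 2 ∧ Squarefree a ∧ u ≠ 0 := by
    intro x hx
    obtain ⟨a, u, h, s⟩ := Nat.sq_mul_squarefree x
    refine ⟨a, u, by rw [mul_comm, h], s, ?_⟩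
    rintro rfl
    simp at h
    omega
  obtain ⟨d₁, u₁, h₁, s₁, n₁⟩ := decomp A (hC.trans hCA)
  obtain ⟨d₂, u₂, h₂, s₂, n₂⟩ := decomp C hC
  obtain ⟨d₃, u₃, h₃, s₃, n₃⟩ := decomp (A - C) (Nat.sub_pos_of_lt hCA)
  obtain ⟨d₄, u₄, h₄, s₄, n₄⟩ := decomp (A + C) (by omega)
  have cS : Nat.Coprime (A + C) C := by simpa using hcop
  have cS' : Nat.Coprime (A + C) A := by simpa using hcop.symm
  have cD : Nat.Coprime (A - C) C := (Nat.coprime_sub_self_left hCA.le).2 hcop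
  have cD' : Nat.Coprime (A - C) A := (Nat.coprime_self_sub_left hCA.le).2 hcop.symm
  have cDS := hcop.sub_add hCA.le hodd
  rw [h₁, h₂] at hcop
  rw [h₃, h₂] at cD
  rw [h₃, h₁] at cD'
  rw [h₄, h₂] at cS
  rw [h₄, h₁] at cS'
  rw [h₃, h₄] at cDS
  have sq : Squarefree (d₁ * d₂ * d₃ * d₄) := by
    rw [Nat.squarefree_mul, Nat.squarefree_mul, Nat.squarefree_mul hcop.of_mul_sq.1]
    · exact ⟨⟨⟨s₁, s₂⟩, s₃⟩, s₄⟩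
    · exact Nat.Coprime.mul_left cD'.of_mul_sq.1.symm cD.of_mul_sq.1.symm
    · exact Nat.Coprime.mul_left
        (Nat.Coprime.mul_left cS'.of_mul_sq.1.symm cS.of_mul_sq.1.symm) cDS.of_mul_sq.1
  refine ⟨⟨d, A, C, A - C, A + C, d₁, d₂, d₃, d₄, u₁, u₂, u₃, u₄, h₁, h₂, h₃, h₄, by omega, rfl, hC,
    Nat.sub_pos_of_lt hCA, hT, sq, by rwa [h₁, h₂], hodd, h, ?_⟩, rfl⟩
  refine SqEquiv.eq_of_squarefree sq hd
    ⟨u₁ * u₂ * u₃ * u₄, 1, by positivity, one_ne_zero, ?_⟩ h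
  calc d₁ * d₂ * d₃ * d₄ * (u₁ * u₂ * u₃ * u₄) ^ 2 =
      (d₁ * u₁ ^ 2) * (d₂ * u₂ ^ 2) * (d₃ * u₃ ^ 2) * (d₄ * u₄ ^ 2) := by ring
    _ = _ := by rw [← h₁, ← h₂, ← h₃, ← h₄]; ring

/-- If `A` and `C` are both odd, they are replaced by `(A + C) / 2` and `(A - C) / 2`. -/
theorem exists_of_sqEquiv {d A C : ℕ} {T : ℝ} (hd : Squarefree d) (hC : 0 < C) (hCA : C < A)
    (hT : (A : ℝ) ≤ T) (hcop : Nat.Coprime A C)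
    (h : SqEquiv d (A * C * (A - C) * (A + C))) : ∃ a : Descent T, a.d = d := by
  rcases Nat.even_or_odd (A + C) with he | ho
  swap
  · exact exists_of_odd hd hC hCA hT hcop ho h
  obtain ⟨A', hA'⟩ := he
  obtain ⟨C', hC'⟩ : ∃ C', A' = C + C' := ⟨A' - C, by omega⟩
  obtain rfl : A = A' + C' := by omega
  obtain rfl : C = A' - C' := by omega
  have hCA' : C' < A' := by omega
  have hC0 : 0 < C' := by omega
  have hcop' : Nat.Coprime A' C' := by
    rw [Nat.coprime_iff_gcd_eq_one, ← Nat.dvd_one, ← hcop]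
    exact Nat.dvd_gcd (dvd_add (Nat.gcd_dvd_left _ _) (Nat.gcd_dvd_right _ _))
      (Nat.dvd_sub (Nat.gcd_dvd_left _ _) (Nat.gcd_dvd_right _ _))
  have hodd : Odd (A' + C') := by
    by_contra hne
    rw [Nat.not_odd_iff_even] at hne
    have h1 : 2 ∣ A' + C' := hne.two_dvd
    have h2 : 2 ∣ A' - C' := by omega
    have := Nat.dvd_gcd h1 h2
    rw [hcop] at this
    omega
  refine exists_of_odd hd hC0 hCA' (le_trans ?_ hT) hcop' hodd ?_
  · exact_mod_cast Nat.le_add_right A' C'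
  · obtain ⟨m, n, hm, hn, e⟩ := h
    refine ⟨m, 2 * n, hm, by positivity, ?_⟩
    rw [e]
    have e1 : A' + C' - (A' - C') = 2 * C' := by omega
    have e2 : A' + C' + (A' - C') = 2 * A' := by omega
    rw [e1, e2]
    ring

variable {T : ℝ} (a : Descent T)

theorem S_pos : 0 < a.S := by have := a.add_S; have := a.C_pos; omega

theorem A_pos : 0 < a.A := by have := a.add_D; have := a.C_pos; omega

theorem copAS : Nat.Coprime a.A a.S := by
  rw [← a.add_S]; simpa using a.copAC

theorem copCS : Nat.Coprime a.C a.S := by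
  rw [← a.add_S]; simpa using a.copAC.symm

theorem copCD : Nat.Coprime a.C a.D := by
  have := a.copAC
  rw [← a.add_D] at this
  simpa using this.symm

theorem copAD : Nat.Coprime a.A a.D := by
  rw [← a.add_D]; simpa using a.copCD

theorem copDS : Nat.Coprime a.D a.S := by
  have h := a.add_D
  have e : a.D = a.A - a.C := by omega
  rw [e, ← a.add_S]
  exact a.copAC.sub_add (by omega) (a.add_S ▸ a.odd)

theorem S_coprime_two : Nat.Coprime a.S 2 := Nat.coprime_two_right.2 a.odd

theorem D_coprime_two : Nat.Coprime a.D 2 := by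
  rw [Nat.coprime_two_right]
  obtain ⟨r, hr⟩ := a.odd
  have := a.add_D
  have := a.add_S
  exact ⟨r - a.C, by omega⟩

theorem sqf₁ : Squarefree a.d₁ :=
  a.sqf.squarefree_of_dvd (((dvd_mul_right _ _).mul_right _).mul_right _)

theorem sqf₂ : Squarefree a.d₂ :=
  a.sqf.squarefree_of_dvd (((dvd_mul_left _ _).mul_right _).mul_right _)

theorem sqf₃ : Squarefree a.d₃ := a.sqf.squarefree_of_dvd ((dvd_mul_left _ _).mul_right _)

theorem sqf₄ : Squarefree a.d₄ := a.sqf.squarefree_of_dvd (dvd_mul_left _ _)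

theorem u₁_pos : 0 < a.u₁ := by
  have h := a.A_pos
  rw [a.hA] at h
  exact pos_of_ne_zero (by rintro h0; simp [h0] at h)

theorem u₂_pos : 0 < a.u₂ := by
  have h := a.C_pos
  rw [a.hC] at h
  exact pos_of_ne_zero (by rintro h0; simp [h0] at h)

theorem u₃_pos : 0 < a.u₃ := by
  have h := a.D_pos
  rw [a.hD] at h
  exact pos_of_ne_zero (by rintro h0; simp [h0] at h)

theorem u₄_pos : 0 < a.u₄ := by
  have h := a.S_pos
  rw [a.hS] at h
  exact pos_of_ne_zero (by rintro h0; simp [h0] at h)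

theorem S_le : (a.S : ℝ) ≤ 2 * T := by
  have h : (a.S : ℝ) ≤ 2 * a.A := by
    have := a.add_S; have := a.add_D
    exact_mod_cast (by omega : a.S ≤ 2 * a.A)
  have := a.A_le
  linarith

theorem A_le' : (a.A : ℝ) ≤ 2 * T := by
  have := a.A_le
  have : (0 : ℝ) ≤ a.A := Nat.cast_nonneg _
  linarith

theorem d_eq_of_A_C_eq {a b : Descent T} (hA : a.A = b.A) (hC : a.C = b.C) : a.d = b.d := by
  have hD : a.D = b.D := by have := a.add_D; have := b.add_D; omega
  have hS : a.S = b.S := by have := a.add_S; have := b.add_S; omega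
  have h := a.equiv
  rw [hA, hC, hD, hS] at h
  exact h.eq_of_squarefree (a.prod ▸ a.sqf) (b.prod ▸ b.sqf) b.equiv

variable {N : ℕ} (B : Finset (Descent T))

/-- The conic `C + (A - C) = A`. -/
theorem card_le_of_drop₄ (hB : ∀ a ∈ B, ∀ b ∈ B, a.d = b.d → a = b)
    (hN : ∀ a ∈ B, a.d₂ * a.d₃ * a.d₁ ≤ N) :
    (B.card : ℝ) ≤ 2 * (N + 2 * (√(2 * T) * √N)) * (1 + Real.log N) ^ 6 := by
  refine card_le_of_injOn_conicPoint B (k₁ := 1) (k₂ := 1) (k₃ := 1)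
    (fun a => (a.d₂, a.d₃, a.d₁)) (fun a => (a.u₂, a.u₃, a.u₁)) ?_ hN ?_ ?_
  all_goals intro a ha
  all_goals
    have c23 := a.copCD
    have c12 := a.copAC
    have c13 := a.copAD
    rw [a.hC, a.hD] at c23
    rw [a.hA, a.hC] at c12
    rw [a.hA, a.hD] at c13
    replace c23 := c23.of_mul_sq
    replace c12 := c12.of_mul_sq
    replace c13 := c13.of_mul_sq
  · exact ⟨one_pos, one_pos, one_pos, a.sqf₂, a.sqf₃, a.sqf₁, c23.1, c12.1.symm, c13.1.symm,
      Nat.coprime_one_right _, Nat.coprime_one_right _, Nat.coprime_one_right _⟩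
  · refine ⟨a.u₂_pos, a.u₃_pos, a.u₁_pos, ?_, ?_, c23.2.2.2, c12.2.2.1.symm, c13.2.2.1.symm, c13.2.1⟩
    · simp only [one_mul, ← a.hA, ← a.hC, ← a.hD, a.add_D]
    · simpa only [one_mul, ← a.hA] using a.A_le'
  · intro b hb he hv
    simp only [Prod.mk.injEq] at he hv
    refine hB a ha b hb (d_eq_of_A_C_eq ?_ ?_)
    · rw [a.hA, b.hA, he.2.2, hv.2.2]
    · rw [a.hC, b.hC, he.1, hv.1]

/-- The conic `A + C = (A + C)`. -/
theorem card_le_of_drop₃ (hB : ∀ a ∈ B, ∀ b ∈ B, a.d = b.d → a = b)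
    (hN : ∀ a ∈ B, a.d₁ * a.d₂ * a.d₄ ≤ N) :
    (B.card : ℝ) ≤ 2 * (N + 2 * (√(2 * T) * √N)) * (1 + Real.log N) ^ 6 := by
  refine card_le_of_injOn_conicPoint B (k₁ := 1) (k₂ := 1) (k₃ := 1)
    (fun a => (a.d₁, a.d₂, a.d₄)) (fun a => (a.u₁, a.u₂, a.u₄)) ?_ hN ?_ ?_
  all_goals intro a ha
  all_goals
    have c12 := a.copAC
    have c14 := a.copAS
    have c24 := a.copCS
    rw [a.hA, a.hC] at c12
    rw [a.hA, a.hS] at c14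
    rw [a.hC, a.hS] at c24
    replace c12 := c12.of_mul_sq
    replace c14 := c14.of_mul_sq
    replace c24 := c24.of_mul_sq
  · exact ⟨one_pos, one_pos, one_pos, a.sqf₁, a.sqf₂, a.sqf₄, c12.1, c14.1, c24.1,
      Nat.coprime_one_right _, Nat.coprime_one_right _, Nat.coprime_one_right _⟩
  · refine ⟨a.u₁_pos, a.u₂_pos, a.u₄_pos, ?_, ?_, c12.2.2.2, c14.2.1, c24.2.1, c24.2.2.1.symm⟩
    · simp only [one_mul, ← a.hA, ← a.hC, ← a.hS, a.add_S]
    · simpa only [one_mul, ← a.hS] using a.S_le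
  · intro b hb he hv
    simp only [Prod.mk.injEq] at he hv
    refine hB a ha b hb (d_eq_of_A_C_eq ?_ ?_)
    · rw [a.hA, b.hA, he.1, hv.1]
    · rw [a.hC, b.hC, he.2.1, hv.2.1]

/-- The conic `(A - C) + (A + C) = 2 A`. -/
theorem card_le_of_drop₂ (hB : ∀ a ∈ B, ∀ b ∈ B, a.d = b.d → a = b)
    (hN : ∀ a ∈ B, a.d₃ * a.d₄ * a.d₁ ≤ N) :
    (B.card : ℝ) ≤ 2 * (N + 2 * (√(2 * T) * √N)) * (1 + Real.log N) ^ 6 := by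
  refine card_le_of_injOn_conicPoint B (k₁ := 1) (k₂ := 1) (k₃ := 2)
    (fun a => (a.d₃, a.d₄, a.d₁)) (fun a => (a.u₃, a.u₄, a.u₁)) ?_ hN ?_ ?_
  all_goals intro a ha
  all_goals
    have c34 := a.copDS
    have c14 := a.copAS
    have c13 := a.copAD
    rw [a.hD, a.hS] at c34
    rw [a.hA, a.hS] at c14
    rw [a.hA, a.hD] at c13
    replace c34 := c34.of_mul_sq
    replace c14 := c14.of_mul_sq
    replace c13 := c13.of_mul_sq
  · exact ⟨one_pos, one_pos, two_pos, a.sqf₃, a.sqf₄, a.sqf₁, c34.1, c13.1.symm, c14.1.symm,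
      Nat.coprime_one_right _, Nat.coprime_one_right _, Nat.coprime_one_right _⟩
  · refine ⟨a.u₃_pos, a.u₄_pos, a.u₁_pos, ?_, ?_, c34.2.2.2, c13.2.2.1.symm, c14.2.2.1.symm, c14.2.1⟩
    · simp only [one_mul, mul_assoc, ← a.hA, ← a.hD, ← a.hS]
      have := a.add_D; have := a.add_S
      omega
    · simp only [mul_assoc, ← a.hA]
      push_cast
      linarith [a.A_le]
  · intro b hb he hv
    simp only [Prod.mk.injEq] at he hv
    have hA : a.A = b.A := by rw [a.hA, b.hA, he.2.2, hv.2.2]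
    have hD : a.D = b.D := by rw [a.hD, b.hD, he.1, hv.1]
    refine hB a ha b hb (d_eq_of_A_C_eq hA ?_)
    have := a.add_D; have := b.add_D
    omega

/-- The conic `2 C + (A - C) = (A + C)`. -/
theorem card_le_of_drop₁ (hB : ∀ a ∈ B, ∀ b ∈ B, a.d = b.d → a = b)
    (hN : ∀ a ∈ B, a.d₂ * a.d₃ * a.d₄ ≤ N) :
    (B.card : ℝ) ≤ 2 * (N + 2 * (√(2 * T) * √N)) * (1 + Real.log N) ^ 6 := by
  -- Here `k₁ = 2`, which is coprime to the odd numbers `d₃` and `d₄`.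
  refine card_le_of_injOn_conicPoint B (k₁ := 2) (k₂ := 1) (k₃ := 1)
    (fun a => (a.d₂, a.d₃, a.d₄)) (fun a => (a.u₂, a.u₃, a.u₄)) ?_ hN ?_ ?_
  all_goals intro a ha
  all_goals
    have c34 := a.copDS
    have c24 := a.copCS
    have c23 := a.copCD
    rw [a.hD, a.hS] at c34
    rw [a.hC, a.hS] at c24
    rw [a.hC, a.hD] at c23
    replace c34 := c34.of_mul_sq
    replace c24 := c24.of_mul_sq
    replace c23 := c23.of_mul_sq
  · exact ⟨two_pos, one_pos, one_pos, a.sqf₂, a.sqf₃, a.sqf₄, c23.1, c24.1, c34.1,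
      Nat.coprime_one_right _,
      a.D_coprime_two.coprime_dvd_left (by rw [a.hD]; exact dvd_mul_right _ _),
      a.S_coprime_two.coprime_dvd_left (by rw [a.hS]; exact dvd_mul_right _ _)⟩
  · refine ⟨a.u₂_pos, a.u₃_pos, a.u₄_pos, ?_, ?_, c23.2.2.2, c24.2.1, c34.2.1, c34.2.2.1.symm⟩
    · simp only [one_mul, mul_assoc, ← a.hC, ← a.hD, ← a.hS]
      have := a.add_D; have := a.add_S
      omega
    · simpa only [one_mul, ← a.hS] using a.S_le
  · intro b hb he hv
    simp only [Prod.mk.injEq] at he hv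
    have hC : a.C = b.C := by rw [a.hC, b.hC, he.1, hv.1]
    have hD : a.D = b.D := by rw [a.hD, b.hD, he.2.1, hv.2.1]
    refine hB a ha b hb (d_eq_of_A_C_eq ?_ hC)
    have := a.add_D; have := b.add_D
    omega

end Descent

/-- One of the four products of three of `d₁, d₂, d₃, d₄` is at most `d ^ (3 / 4)`, because the four
products multiply to `d ^ 3`; the corresponding conic is used. -/
theorem card_le_of_exists_descent {X N : ℕ} {T : ℝ} (hN : ∀ E : ℕ, E ^ 4 ≤ X ^ 3 → E ≤ N)
    (Q : Finset ℕ) (hQ : ∀ d ∈ Q, d ≤ X ∧ ∃ a : Descent T, a.d = d) :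
    (Q.card : ℝ) ≤ 8 * (N + 2 * (√(2 * T) * √N)) * (1 + Real.log N) ^ 6 := by
  classical
  choose hX f hf using hQ
  set B : Finset (Descent T) := Q.attach.image fun d => f d.1 d.2 with hBdef
  have hcard : B.card = Q.card := by
    rw [hBdef, Finset.card_image_of_injective, Finset.card_attach]
    intro d d' h
    apply Subtype.ext
    rw [← hf d.1 d.2, ← hf d'.1 d'.2]
    exact congrArg _ h
  have hmem : ∀ a ∈ B, ∃ d, ∃ hd : d ∈ Q, f d hd = a := by
    intro a ha
    obtain ⟨d, -, rfl⟩ := Finset.mem_image.1 ha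
    exact ⟨d.1, d.2, rfl⟩
  have hB : ∀ a ∈ B, ∀ b ∈ B, a.d = b.d → a = b := by
    intro a ha b hb hab
    obtain ⟨d, hd, rfl⟩ := hmem a ha
    obtain ⟨d', hd', rfl⟩ := hmem b hb
    rw [hf, hf] at hab
    subst hab
    rfl
  have hsub : ∀ (p : Descent T → Prop) [DecidablePred p], ∀ a ∈ B.filter p, ∀ b ∈ B.filter p, a.d = b.d → a = b :=
    fun p _ a ha b hb => hB a (Finset.mem_filter.1 ha).1 b (Finset.mem_filter.1 hb).1
  have b₁ := Descent.card_le_of_drop₁ (N := N) (B.filter fun a => a.d₂ * a.d₃ * a.d₄ ≤ N) (hsub _)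
    fun a ha => (Finset.mem_filter.1 ha).2
  have b₂ := Descent.card_le_of_drop₂ (N := N) (B.filter fun a => a.d₃ * a.d₄ * a.d₁ ≤ N) (hsub _)
    fun a ha => (Finset.mem_filter.1 ha).2
  have b₃ := Descent.card_le_of_drop₃ (N := N) (B.filter fun a => a.d₁ * a.d₂ * a.d₄ ≤ N) (hsub _)
    fun a ha => (Finset.mem_filter.1 ha).2
  have b₄ := Descent.card_le_of_drop₄ (N := N) (B.filter fun a => a.d₂ * a.d₃ * a.d₁ ≤ N) (hsub _)
    fun a ha => (Finset.mem_filter.1 ha).2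
  have hcover : B ⊆ ((B.filter fun a => a.d₂ * a.d₃ * a.d₄ ≤ N) ∪
      (B.filter fun a => a.d₃ * a.d₄ * a.d₁ ≤ N)) ∪ ((B.filter fun a => a.d₁ * a.d₂ * a.d₄ ≤ N) ∪
      (B.filter fun a => a.d₂ * a.d₃ * a.d₁ ≤ N)) := by
    intro a ha
    simp only [Finset.mem_union, Finset.mem_filter, ha, true_and]
    by_contra! hcon
    obtain ⟨⟨h1, h2⟩, h3, h4⟩ := hcon
    have hlt : ∀ E : ℕ, N < E → X ^ 3 < E ^ 4 := fun E hE => by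
      by_contra! hle
      exact absurd (hN E hle) (by omega)
    have hdX : a.d ≤ X := by
      obtain ⟨d, hd, rfl⟩ := hmem a ha
      rw [hf]
      exact hX d hd
    have m1 := Nat.mul_lt_mul'' (hlt _ h1) (hlt _ h2)
    have m2 := Nat.mul_lt_mul'' (hlt _ h3) (hlt _ h4)
    have m3 := Nat.mul_lt_mul'' m1 m2
    have e1 : (a.d₂ * a.d₃ * a.d₄) ^ 4 * (a.d₃ * a.d₄ * a.d₁) ^ 4 *
        ((a.d₁ * a.d₂ * a.d₄) ^ 4 * (a.d₂ * a.d₃ * a.d₁) ^ 4) = a.d ^ 12 := by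
      rw [← a.prod]; ring
    have e2 : X ^ 3 * X ^ 3 * (X ^ 3 * X ^ 3) = X ^ 12 := by ring
    rw [e1, e2] at m3
    exact absurd (Nat.pow_le_pow_left hdX 12) (by omega)
  have hle := (Finset.card_le_card hcover).trans ((Finset.card_union_le _ _).trans
    (add_le_add (Finset.card_union_le _ _) (Finset.card_union_le _ _)))
  rw [hcard] at hle
  have hle' : (Q.card : ℝ) ≤ (((B.filter fun a => a.d₂ * a.d₃ * a.d₄ ≤ N).card : ℝ) +
      (B.filter fun a => a.d₃ * a.d₄ * a.d₁ ≤ N).card) +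
      ((B.filter fun a => a.d₁ * a.d₂ * a.d₄ ≤ N).card +
      (B.filter fun a => a.d₂ * a.d₃ * a.d₁ ≤ N).card) := by exact_mod_cast hle
  linarith

/-! ### From points of small height to descent data -/

namespace CongruentTwist

/-- For `x = a / b`, the equation makes `d` the squarefree part of `|a b (a - b) (a + b)|`. The signs
play no role: `A` and `C` are the maximum and the minimum of `|a|` and `b`. -/
theorem exists_descent {d : ℕ+} {T : ℝ} (hd : Squarefree (d : ℕ)) {x y : ℚ}
    (h : (d : ℚ) * y ^ 2 = x ^ 3 - x) (hy : y ≠ 0) (hT : Height.mulHeight₁ x ≤ T) :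
    ∃ a : Descent T, a.d = (d : ℕ) := by
  set α := x.num.natAbs with hα
  set b := x.den with hb
  have hb0 : b ≠ 0 := x.den_nz
  have hn0 : y.den ≠ 0 := y.den_nz
  have hm0 : y.num.natAbs ≠ 0 := by simpa using hy
  have hcop : Nat.Coprime α b := x.reduced
  have hz : (d : ℤ) * (y.num * b ^ 2) ^ 2 = x.num * b * (x.num ^ 2 - b ^ 2) * (y.den : ℤ) ^ 2 := by
    have hbq : (b : ℚ) ≠ 0 := by exact_mod_cast hb0
    have hnq : (y.den : ℚ) ≠ 0 := by exact_mod_cast hn0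
    have h' := h
    rw [← Rat.num_div_den x, ← Rat.num_div_den y, ← hb] at h'
    field_simp at h'
    have : (d : ℚ) * (y.num * b ^ 2) ^ 2 = x.num * b * (x.num ^ 2 - b ^ 2) * (y.den : ℚ) ^ 2 := by
      linear_combination (b : ℚ) * h'
    exact_mod_cast this
  have hnat : (d : ℕ) * (y.num.natAbs * b ^ 2) ^ 2 =
      α * b * (x.num ^ 2 - b ^ 2 : ℤ).natAbs * y.den ^ 2 := by
    have := congrArg Int.natAbs hz
    simpa [Int.natAbs_mul, Int.natAbs_pow] using this
  have hpos : 0 < α * b * (x.num ^ 2 - b ^ 2 : ℤ).natAbs * y.den ^ 2 := by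
    rw [← hnat]
    have := d.pos
    positivity
  have hα0 : 0 < α := by
    rcases Nat.eq_zero_or_pos α with h0 | h0
    · rw [h0] at hpos; simp at hpos
    · exact h0
  have hne : α ≠ b := by
    intro hab
    have : x.num ^ 2 - (b : ℤ) ^ 2 = 0 := by
      rw [← hab, hα]; simp
    rw [this] at hpos
    simp at hpos
  have hsq : (x.num : ℤ) ^ 2 = (α : ℤ) ^ 2 := by simp [hα]
  rw [Rat.mulHeight₁_eq_max, ← hα, ← hb] at hT
  push_cast at hT
  rcases lt_or_gt_of_ne hne with hlt | hlt
  · refine Descent.exists_of_sqEquiv hd hα0 hlt ((le_max_right _ _).trans hT) hcop.symm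
      ⟨y.num.natAbs * b ^ 2, y.den, by positivity, hn0, ?_⟩
    rw [hnat]
    have : (x.num ^ 2 - b ^ 2 : ℤ).natAbs = (b - α) * (b + α) := by
      have e : (x.num ^ 2 - b ^ 2 : ℤ) = -(((b - α) * (b + α) : ℕ) : ℤ) := by
        rw [hsq]; push_cast [hlt.le]; ring
      rw [e, Int.natAbs_neg, Int.natAbs_natCast]
    rw [this]; ring
  · refine Descent.exists_of_sqEquiv hd (Nat.pos_of_ne_zero hb0) hlt ((le_max_left _ _).trans hT)
      hcop ⟨y.num.natAbs * b ^ 2, y.den, by positivity, hn0, ?_⟩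
    rw [hnat]
    have : (x.num ^ 2 - b ^ 2 : ℤ).natAbs = (α - b) * (α + b) := by
      have e : (x.num ^ 2 - b ^ 2 : ℤ) = (((α - b) * (α + b) : ℕ) : ℤ) := by
        rw [hsq]; push_cast [hlt.le]; ring
      rw [e, Int.natAbs_natCast]
    rw [this]; ring

/-- The factor `2` makes the inequality strict for the infimum. -/
theorem ofReal_lt_eta {d : ℕ+} {r T : ℝ} (hr : 0 < r) (hT : (2 * Real.exp 1 * r) ^ 2 ≤ T)
    (h : ∀ (x y : ℚ), (d : ℚ) * y ^ 2 = x ^ 3 - x → y ≠ 0 → T < Height.mulHeight₁ x) :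
    ENNReal.ofReal r < eta d := by
  have h1 : ENNReal.ofReal r < ENNReal.ofReal (2 * r) :=
    (ENNReal.ofReal_lt_ofReal_iff (by positivity)).2 (by linarith)
  refine h1.trans_le (le_iInf₂ fun P hP => ENNReal.ofReal_le_ofReal ?_)
  obtain ⟨x, y, hxy, hy, rfl⟩ := Point.exists_of_not_isOfFinAddOrder hP
  refine le_trans ?_ (exp_mul_sqrt_mulHeight₁_le_exp_canonicalHeight hP)
  have h2 : 2 * Real.exp 1 * r ≤ √(Height.mulHeight₁ x) :=
    Real.le_sqrt_of_sq_le (hT.trans (h x y hxy hy).le)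
  calc 2 * r = Real.exp (-1) * (2 * Real.exp 1 * r) := by
        rw [Real.exp_neg]; field_simp
    _ ≤ _ := by gcongr

end CongruentTwist

/-! ### Density of the squarefree integers and conclusion -/

/-- At most `∑ X / k²` over `k ≥ 2`, so at most `3 X / 4`, of the integers up to `X` are not
squarefree. -/
theorem quarter_le_card_squarefree (X : ℕ) :
    (X : ℝ) / 4 ≤ ((Finset.Icc 1 X).filter Squarefree).card := by
  have hsum : ∑ k ∈ Finset.Icc 2 X, ((k : ℝ) ^ 2)⁻¹ ≤ 3 / 4 := by
    rcases lt_or_ge X 2 with h | h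
    · rw [Finset.Icc_eq_empty (by omega)]; norm_num
    · have e : Finset.Icc 2 X = insert 2 (Finset.Ioc 2 X) := by
        ext k; simp only [Finset.mem_Icc, Finset.mem_insert, Finset.mem_Ioc]; omega
      rw [e, Finset.sum_insert (by simp)]
      have := sum_Ioc_inv_sq_le_sub (α := ℝ) (k := 2) (n := X) two_ne_zero h
      have h0 : (0 : ℝ) ≤ (X : ℝ)⁻¹ := by positivity
      push_cast at this ⊢
      norm_num at this ⊢
      linarith
  have hsub : (Finset.Icc 1 X).filter (fun d => ¬ Squarefree d) ⊆
      (Finset.Icc 2 X).biUnion fun k => (Finset.Ioc 0 X).filter fun d => k ^ 2 ∣ d := by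
    intro d hd
    simp only [Finset.mem_filter, Finset.mem_Icc] at hd
    obtain ⟨⟨h1, hX⟩, hns⟩ := hd
    rw [Squarefree] at hns
    push Not at hns
    obtain ⟨k, hk, hu⟩ := hns
    rw [Nat.isUnit_iff] at hu
    have hk0 : k ≠ 0 := by rintro rfl; simp at hk; omega
    have hkd : k ≤ d := (Nat.le_mul_self k).trans (Nat.le_of_dvd h1 hk)
    simp only [Finset.mem_biUnion, Finset.mem_Icc, Finset.mem_filter, Finset.mem_Ioc]
    exact ⟨k, ⟨by omega, by omega⟩, ⟨by omega, hX⟩, by rwa [sq]⟩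
  have hns : (((Finset.Icc 1 X).filter (fun d => ¬ Squarefree d)).card : ℝ) ≤ 3 / 4 * X := by
    calc (((Finset.Icc 1 X).filter (fun d => ¬ Squarefree d)).card : ℝ)
        ≤ ((∑ k ∈ Finset.Icc 2 X, ((Finset.Ioc 0 X).filter fun d => k ^ 2 ∣ d).card : ℕ) : ℝ) := by
          exact_mod_cast (Finset.card_le_card hsub).trans Finset.card_biUnion_le
      _ = ∑ k ∈ Finset.Icc 2 X, ((X / k ^ 2 : ℕ) : ℝ) := by
          push_cast [Nat.Ioc_filter_dvd_card_eq_div]; rfl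
      _ ≤ ∑ k ∈ Finset.Icc 2 X, X * ((k : ℝ) ^ 2)⁻¹ := by
          refine Finset.sum_le_sum fun k _ => ?_
          rw [← div_eq_mul_inv]
          exact_mod_cast Nat.cast_div_le (α := ℝ) (m := X) (n := k ^ 2)
      _ = X * ∑ k ∈ Finset.Icc 2 X, ((k : ℝ) ^ 2)⁻¹ := by rw [Finset.mul_sum]
      _ ≤ X * (3 / 4) := by gcongr
      _ = _ := by ring
  have htot := Finset.card_filter_add_card_filter_not (s := Finset.Icc 1 X) (fun d => Squarefree d)
  rw [Nat.card_Icc, Nat.add_sub_cancel] at htot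
  have htot' : (((Finset.Icc 1 X).filter Squarefree).card : ℝ) +
      ((Finset.Icc 1 X).filter (fun d => ¬ Squarefree d)).card = X := by exact_mod_cast htot
  linarith

theorem image_coe_squarefreeUpTo (X : ℕ) :
    (fun d : ℕ+ => (d : ℕ)) '' squarefreeUpTo X =
      ((Finset.Icc 1 X).filter Squarefree : Finset ℕ) := by
  ext n
  simp only [squarefreeUpTo, Set.mem_image, Set.mem_ofPred_eq, Finset.coe_filter, Finset.mem_Icc]
  constructor
  · rintro ⟨d, ⟨h1, h2⟩, rfl⟩
    exact ⟨⟨d.pos, h2⟩, h1⟩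
  · rintro ⟨⟨h1, h2⟩, h3⟩
    exact ⟨⟨n, h1⟩, ⟨h3, h2⟩, rfl⟩

theorem finite_squarefreeUpTo (X : ℕ) : (squarefreeUpTo X).Finite :=
  Set.Finite.of_finite_image (f := fun d : ℕ+ => (d : ℕ))
    (by rw [image_coe_squarefreeUpTo]; exact Finset.finite_toSet _) PNat.coe_injective.injOn

theorem quarter_le_ncard_squarefreeUpTo (X : ℕ) : (X : ℝ) / 4 ≤ (squarefreeUpTo X).ncard := by
  rw [← Set.ncard_image_of_injective _ PNat.coe_injective, image_coe_squarefreeUpTo,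
    Set.ncard_coe_finset]
  exact quarter_le_card_squarefree X

/-- It is enough to bound the number of exceptions by `o(X)`, because the squarefree integers have
positive density. -/
theorem almostEverySquarefree_of_bound {P : ℕ+ → Prop} {g : ℕ → ℝ}
    (hg : Tendsto (fun X : ℕ => g X / X) atTop (𝓝 0))
    (h : ∀ᶠ X : ℕ in atTop, (({d ∈ squarefreeUpTo X | ¬ P d}).ncard : ℝ) ≤ g X) :
    AlmostEverySquarefree P := by
  unfold AlmostEverySquarefree
  have hlow : Tendsto (fun X : ℕ => 1 - 4 * (g X / X)) atTop (𝓝 1) := by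
    simpa using (hg.const_mul 4).const_sub 1
  refine tendsto_of_tendsto_of_tendsto_of_le_of_le' hlow tendsto_const_nhds ?_ ?_
  · filter_upwards [h, eventually_gt_atTop 0] with X hX hX0
    have hfin := finite_squarefreeUpTo X
    have hq := quarter_le_ncard_squarefreeUpTo X
    have hX0' : (0 : ℝ) < X := by exact_mod_cast hX0
    have hsplit : ({d ∈ squarefreeUpTo X | P d}).ncard + ({d ∈ squarefreeUpTo X | ¬ P d}).ncard =
        (squarefreeUpTo X).ncard := by
      rw [← Set.ncard_union_eq _ (hfin.subset (Set.sep_subset _ _))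
        (hfin.subset (Set.sep_subset _ _))]
      · congr 1
        ext d
        simp only [Set.mem_union, Set.mem_sep_iff]
        tauto
      · rw [Set.disjoint_left]
        rintro d ⟨_, h1⟩ ⟨_, h2⟩
        exact h2 h1
    have hsplit' : (({d ∈ squarefreeUpTo X | P d}).ncard : ℝ) +
        ({d ∈ squarefreeUpTo X | ¬ P d}).ncard = (squarefreeUpTo X).ncard := by
      exact_mod_cast hsplit
    have hpos : (0 : ℝ) < (squarefreeUpTo X).ncard := by linarith
    have hg0 : 0 ≤ g X := le_trans (Nat.cast_nonneg _) hX
    rw [le_div_iff₀ hpos]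
    have h1 : g X ≤ 4 * (g X / X) * (squarefreeUpTo X).ncard := by
      calc g X = 4 * (g X / X) * (X / 4) := by field_simp
        _ ≤ _ := by gcongr
    nlinarith
  · filter_upwards with X
    refine div_le_one_of_le₀ ?_ (Nat.cast_nonneg _)
    exact_mod_cast Set.ncard_le_ncard (Set.sep_subset _ _) (finite_squarefreeUpTo X)

theorem tendsto_rpow_mul_log_pow {δ : ℝ} (hδ : 0 < δ) (K : ℝ) {n : ℕ} (hn : 0 < n) :
    Tendsto (fun X : ℕ => K * (X : ℝ) ^ (1 - δ) * (1 + Real.log X) ^ n / X) atTop (𝓝 0) := by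
  have h1 : Tendsto (fun x : ℝ => (1 + Real.log x) ^ n / x ^ δ) atTop (𝓝 0) := by
    have hp : 0 < δ / n := by positivity
    have hlo : (fun x : ℝ => 1 + Real.log x) =o[atTop] fun x => x ^ (δ / n) := by
      refine Asymptotics.IsLittleO.add ?_ (isLittleO_log_rpow_atTop hp)
      rw [Asymptotics.isLittleO_one_left_iff]
      exact tendsto_norm_atTop_atTop.comp (tendsto_rpow_atTop hp)
    refine ((hlo.pow hn).congr' EventuallyEq.rfl ?_).tendsto_div_nhds_zero
    filter_upwards [eventually_ge_atTop 0] with x hx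
    rw [← Real.rpow_mul_natCast hx, div_mul_cancel₀ _ (by positivity)]
  have h2 := (h1.comp tendsto_natCast_atTop_atTop).const_mul K
  rw [mul_zero] at h2
  refine h2.congr' ?_
  filter_upwards [eventually_gt_atTop 0] with X hX
  have hX' : (0 : ℝ) < X := by exact_mod_cast hX
  simp only [Function.comp]
  rw [Real.rpow_sub hX', Real.rpow_one]
  field_simp

/-- The number of exceptions up to `X` is at most `O(X ^ (1 - ε) (log X) ^ 6)`. -/
theorem ncard_exceptions_le {ε : ℝ} (h0 : 0 < ε) (h1 : ε ≤ 1 / 4) {X : ℕ} (hX : 0 < X) :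
    (({d ∈ squarefreeUpTo X | ¬ ENNReal.ofReal ((d : ℝ) ^ (5 / 8 - ε)) < CongruentTwist.eta d}).ncard
      : ℝ) ≤ 8 * (1 + 2 * (√8 * Real.exp 1)) * (X : ℝ) ^ (1 - ε) * (1 + Real.log X) ^ 6 := by
  have hXr : (1 : ℝ) ≤ X := by exact_mod_cast hX
  set θ : ℝ := 5 / 8 - ε with hθ
  have hθ0 : 0 ≤ θ := by linarith
  set T : ℝ := (2 * Real.exp 1 * (X : ℝ) ^ θ) ^ 2 with hT
  set N : ℕ := ⌊(X : ℝ) ^ (3 / 4 : ℝ)⌋₊ with hN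
  have hNle : (N : ℝ) ≤ (X : ℝ) ^ (3 / 4 : ℝ) := Nat.floor_le (by positivity)
  have hNprop : ∀ E : ℕ, E ^ 4 ≤ X ^ 3 → E ≤ N := by
    intro E hE
    apply Nat.le_floor
    have hE' : (E : ℝ) ^ (4 : ℕ) ≤ (X : ℝ) ^ (3 : ℕ) := by exact_mod_cast hE
    have h2 : ((X : ℝ) ^ (3 / 4 : ℝ)) ^ (4 : ℕ) = (X : ℝ) ^ (3 : ℕ) := by
      rw [← Real.rpow_mul_natCast (by positivity), ← Real.rpow_natCast]
      norm_num
    rw [← h2] at hE'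
    exact le_of_pow_le_pow_left₀ (by norm_num) (by positivity) hE'
  set Q := {d ∈ squarefreeUpTo X | ¬ ENNReal.ofReal ((d : ℝ) ^ θ) < CongruentTwist.eta d} with hQ
  have hfin : Q.Finite := (finite_squarefreeUpTo X).subset (Set.sep_subset _ _)
  have hcard : Q.ncard = (hfin.toFinset.image fun d : ℕ+ => (d : ℕ)).card := by
    rw [Finset.card_image_of_injective _ PNat.coe_injective, Set.ncard_eq_toFinset_card Q hfin]
  have key := card_le_of_exists_descent (T := T) hNprop
    (hfin.toFinset.image fun d : ℕ+ => (d : ℕ)) (by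
      intro n hn
      obtain ⟨d, hd, rfl⟩ := Finset.mem_image.1 hn
      rw [Set.Finite.mem_toFinset] at hd
      obtain ⟨⟨hsq, hdX⟩, hbad⟩ := hd
      refine ⟨hdX, ?_⟩
      by_contra hno
      apply hbad
      have hd1 : (0 : ℝ) < d := by exact_mod_cast d.pos
      have hdX' : (d : ℝ) ≤ X := by exact_mod_cast hdX
      refine CongruentTwist.ofReal_lt_eta (T := T) (by positivity) ?_ ?_
      · rw [hT]; gcongr
      · intro x y hxy hy
        by_contra! hle
        exact hno (CongruentTwist.exists_descent hsq hxy hy hle))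
  rw [← hcard] at key
  refine key.trans ?_
  have hsT : √(2 * T) * √N ≤ √8 * Real.exp 1 * (X : ℝ) ^ (1 - ε) := by
    have e1 : √(2 * T) = √8 * Real.exp 1 * (X : ℝ) ^ θ := by
      have : 2 * T = 8 * (Real.exp 1 * (X : ℝ) ^ θ) ^ 2 := by rw [hT]; ring
      rw [this, Real.sqrt_mul (by norm_num), Real.sqrt_sq (by positivity)]
      ring
    have e2 : √N ≤ (X : ℝ) ^ (3 / 8 : ℝ) := by
      refine Real.sqrt_le_iff.2 ⟨by positivity, hNle.trans (le_of_eq ?_)⟩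
      rw [← Real.rpow_mul_natCast (by positivity)]
      norm_num
    have e3 : (X : ℝ) ^ (1 - ε) = (X : ℝ) ^ θ * (X : ℝ) ^ (3 / 8 : ℝ) := by
      rw [← Real.rpow_add (by positivity), hθ]
      congr 1; ring
    rw [e1, e3, ← mul_assoc]
    gcongr
  have hN1 : (N : ℝ) ≤ (X : ℝ) ^ (1 - ε) :=
    hNle.trans (Real.rpow_le_rpow_of_exponent_le hXr (by linarith))
  have hNX : (N : ℝ) ≤ X :=
    hNle.trans ((Real.rpow_le_rpow_of_exponent_le hXr (by norm_num : (3 / 4 : ℝ) ≤ 1)).trans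
      (Real.rpow_one _).le)
  have hlog0 : 0 ≤ Real.log N := Real.log_natCast_nonneg N
  have hlog : Real.log N ≤ Real.log X := by
    rcases Nat.eq_zero_or_pos N with h | h
    · rw [h]; simpa using Real.log_natCast_nonneg X
    · exact Real.log_le_log (by exact_mod_cast h) hNX
  calc 8 * (N + 2 * (√(2 * T) * √N)) * (1 + Real.log N) ^ 6
      ≤ 8 * ((X : ℝ) ^ (1 - ε) + 2 * (√8 * Real.exp 1 * (X : ℝ) ^ (1 - ε))) *
        (1 + Real.log X) ^ 6 := by gcongr
    _ = _ := by ring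

theorem theorem2 (ε : ℝ) (hε : 0 < ε) :
    AlmostEverySquarefree (fun d : ℕ+ =>
      ENNReal.ofReal ((d : ℝ) ^ (5 / 8 - ε)) < CongruentTwist.eta d) := by
  -- The claim for `min ε (1 / 4)` is stronger; for it the exponent of `d` is nonnegative.
  set δ := min ε (1 / 4) with hδ
  have hδ0 : 0 < δ := lt_min hε (by norm_num)
  refine almostEverySquarefree_of_bound
    (tendsto_rpow_mul_log_pow hδ0 (8 * (1 + 2 * (√8 * Real.exp 1))) (n := 6) (by norm_num)) ?_
  filter_upwards [eventually_gt_atTop 0] with X hX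
  refine le_trans ?_ (ncard_exceptions_le hδ0 (min_le_right _ _) hX)
  have hsub : {d ∈ squarefreeUpTo X |
        ¬ ENNReal.ofReal ((d : ℝ) ^ (5 / 8 - ε)) < CongruentTwist.eta d} ⊆
      {d ∈ squarefreeUpTo X |
        ¬ ENNReal.ofReal ((d : ℝ) ^ (5 / 8 - δ)) < CongruentTwist.eta d} := by
    rintro d ⟨hd, hbad⟩
    refine ⟨hd, fun hgood => hbad (lt_of_le_of_lt (ENNReal.ofReal_le_ofReal ?_) hgood)⟩
    have h1 : (1 : ℝ) ≤ d := by exact_mod_cast d.pos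
    exact Real.rpow_le_rpow_of_exponent_le h1 (by linarith [min_le_left ε (1 / 4)])
  exact_mod_cast Set.ncard_le_ncard hsub ((finite_squarefreeUpTo X).subset (Set.sep_subset _ _))
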